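/- **Setting.** Let $V$ be a finite set of variables, each $V_j$ with a standard Borel domain $\mathcal D_{V_j}$, partitioned into observable variables $\mathbf O$ and latent variables $\mathbf L$; the action $X$ is in $\mathbf O$ and the reward $Y$ is in $\mathbf L$. A labeled DAG $\mathcal G^{\mathcal L}=(V,E,\mathcal L)$ is a DAG $(V,E)$ together with, for each edge $(V_i,V_j)$, a (possibly empty) set $\mathcal L_{(V_i,V_j)}$ of labels; a label $\ell$ is a realization of some set of variables $\mathbf V'\subseteq\mathbf{Pa}(V_j)\setminus\{V_i\}$. The set $\mathbf C(\mathcal L)$ of context variables consists of all variables a realization of which occurs in some label. $\mathcal M_{\langle\mathcal G^{\mathcal L}\rangle}$ is the class of structural causal models $M$ in which every $V_j$ is a measurable function $f_j(\mathbf{Pa}(V_j),U_j)$ of its parents in $(V,E)$ and an exogenous term $U_j$, the $U_j$ being mutually independent, and in which every label holds: for each $\ell\in\mathcal L_{(V_i,V_j)}$, whenever the values $\mathbf{pa}$ of $\mathbf{Pa}(V_j)$ extend $\ell$, the law of $f_j(\mathbf{pa},U_j)$ does not change when the value of $V_i$ in $\mathbf{pa}$ is changed. $P^M$ denotes the law of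 $V$ in $M$. Let $\mathbf{Pa}^\Pi\subseteq\mathbf O\setminus\mathbf{De}(X)$, where the descendants $\mathbf{De}(X)$ include $X$. The policy space $\Pi$ is the set of all Markov kernels $\pi(X\mid\mathbf{Pa}^\Pi)$. $P^M(\cdot\mid do(\pi))$ is the law of $V$ when the mechanism of $X$ in $M$ is replaced by $\pi$. Let $P(\mathbf O)$ be a distribution of the observable variables. $P(y)$ is *imitable w.r.t.* $\langle\mathcal G^{\mathcal L},\Pi,P(\mathbf O)\rangle$ if for every $M\in\mathcal M_{\langle\mathcal G^{\mathcal L}\rangle}$ with $P^M(\mathbf O)=P(\mathbf O)$ there is $\pi\in\Pi$ such that $P^M(y\mid do(\pi))=P^M(y)$ (equality of the laws of $Y$). Given a realization $\mathbf c$ of a set of variables $\mathbf C$, an edge $(V_i,V_j)$ is *absent given* $\mathbf c$ if every realization of $V$ that agrees with $\mathbf c$ on $\mathbf C$ extends some label of $(V_i,V_j)$ (in particular, if $\mathbf c$ itself extends a label of the edge). $\mathcal G^{\mathcal L}(\mathbf c)$ is the DAG obtained from $(V,E)$ by deleting all edges that are absent given $\mathbf c$; $\mathcal G^{\mathcal L}(\mathbf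 c)\cup\Pi$ is obtained from it by adding the edges from $\mathbf{Pa}^\Pi$ to $X$, and $\mathcal G^{\mathcal L}(\mathbf c)_{\underline X}$ by removing the edges going out of $X$. As usual, d-separation of $X$ and $Y$ by a set includes that the set contains neither $X$ nor $Y$. **Proposition.** Let $\mathbf C\subseteq\mathbf{Pa}^\Pi\cap\mathbf C(\mathcal L)$, where each variable in $\mathbf C$ is discrete (its domain is countable). Suppose that for every realization $\mathbf c\in\mathcal D_{\mathbf C}$ at least one of the following holds. * There is a context-specific surrogate, i.e. a set $\mathbf S_{\mathbf c}\subseteq\mathbf O$ such that $X$ and $Y$ are d-separated by $\mathbf S_{\mathbf c}\cup\mathbf C$ in $\mathcal G^{\mathcal L}(\mathbf c)\cup\Pi$, for which the equation $P(\mathbf S_{\mathbf c}\mid do(\pi),\mathbf C=\mathbf c)=P(\mathbf S_{\mathbf c}\mid\mathbf C=\mathbf c)$ is solvable: for every $M\in\mathcal M_{\langle\mathcal G^{\mathcal L}\rangle}$ with $P^M(\mathbf O)=P(\mathbf O)$ there is $\pi_{\mathbf c}\in\Pi$ with $P^M(\mathbf S_{\mathbf c}\mid do(\pi_{\mathbf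 c}),\mathbf C=\mathbf c)=P^M(\mathbf S_{\mathbf c}\mid\mathbf C=\mathbf c)$ (an equation that holds vacuously if $P^M(\mathbf C=\mathbf c)=0$). * There is a set $\mathbf Z_{\mathbf c}\subseteq\mathbf{Pa}^\Pi$ such that $X$ and $Y$ are d-separated by $\mathbf Z_{\mathbf c}\cup\mathbf C$ in $\mathcal G^{\mathcal L}(\mathbf c)_{\underline X}$. Then $P(y)$ is imitable w.r.t. $\langle\mathcal G^{\mathcal L},\Pi,P(\mathbf O)\rangle$. -/

import Mathlib

open MeasureTheory ProbabilityTheory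

universe u v w

namespace Imitation

/-! ### Directed graphs and d-separation -/

/-- `d` is a descendant of `a` (every vertex is a descendant of itself). -/
def IsDesc {V : Type u} (G : Digraph V) (a d : V) : Prop :=
  Relation.ReflTransGen G.Adj a d

/-- A path from `x` to `y`: pairwise distinct vertices, consecutive ones being joined by an edge
in one direction or the other. -/
def IsPath {V : Type u} (G : Digraph V) (x y : V) (l : List V) : Prop :=
  l.Nodup ∧ l.head? = some x ∧ l.getLast? = some y ∧ l.IsChain (fun a b => G.Adj a b ∨ G.Adj b a)

/-- A path is blocked by `Z` if it has three consecutive vertices `a, b, c` such that either `b` is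
the middle of a chain or a fork and `b ∈ Z`, or `b` is a collider and neither `b` nor any of its
descendants is in `Z`. -/
def Blocked {V : Type u} (G : Digraph V) (Z : Set V) (l : List V) : Prop :=
  ∃ a b c : V, [a, b, c] <:+: l ∧
    ((¬ (G.Adj a b ∧ G.Adj c b) ∧ b ∈ Z) ∨
      ((G.Adj a b ∧ G.Adj c b) ∧ ∀ d, IsDesc G b d → d ∉ Z))

/-- `x` and `y` are d-separated by `Z`, a set containing neither of them. -/
def DSep {V : Type u} (G : Digraph V) (x y : V) (Z : Set V) : Prop :=
  x ∉ Z ∧ y ∉ Z ∧ ∀ l : List V, IsPath G x y l → Blocked G Z l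

/-- The graph with all edges going out of `x` removed. -/
def cutOut {V : Type u} (G : Digraph V) (x : V) : Digraph V where
  Adj i j := G.Adj i j ∧ i ≠ x

/-- The graph with all edges from `P` to `x` added. -/
def addPolicy {V : Type u} (G : Digraph V) (P : Set V) (x : V) : Digraph V where
  Adj i j := G.Adj i j ∨ (i ∈ P ∧ j = x)

/-- A directed acyclic graph. -/
structure DAG (V : Type u) extends Digraph V where
  acyclic : ∀ v, ¬ Relation.TransGen Adj v v

theorem DAG.wellFounded {V : Type u} [Finite V] (G : DAG V) : WellFounded G.Adj := by
  have : Std.Irrefl (Relation.TransGen G.Adj) := ⟨G.acyclic⟩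
  exact Subrelation.wf (fun h => Relation.TransGen.single h)
    (Finite.wellFounded_of_trans_of_irrefl (Relation.TransGen G.Adj))

/-! ### Labeled DAGs -/

/-- A realization of a set of variables, together with that set. -/
abbrev PartialAssignment {V : Type u} (D : V → Type v) :=
  Σ S : Set V, ∀ s : S, D s

/-- A labeled DAG over variables `V` with domains `D`: each edge `i → j` carries a (possibly empty)
set of labels, which are realizations of sets of parents of `j` other than `i`. -/
structure LDAG {V : Type u} (D : V → Type v) extends DAG V where
  label : V → V → Set (PartialAssignment D)
  label_edge : ∀ i j, ∀ l ∈ label i j, Adj i j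
  label_dom : ∀ i j, ∀ l ∈ label i j, ∀ s ∈ l.1, Adj s j ∧ s ≠ i

/-- The context variables: those of which some realization appears in a label. -/
def LDAG.contextVars {V : Type u} {D : V → Type v} (L : LDAG D) : Set V :=
  {i | ∃ k j, L.Adj k j ∧ i ≠ k ∧ i ≠ j ∧ ∃ l ∈ L.label k j, i ∈ l.1}

/-- The edge `i → j` is absent given `C = c`: every assignment that agrees with `c` extends one of
the labels of the edge. In particular this is the case if `c` itself extends a label. -/
def LDAG.AbsentGiven {V : Type u} {D : V → Type v} (L : LDAG D) (C : Set V) (c : ∀ s : C, D s)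
    (i j : V) : Prop :=
  ∀ a : ∀ s, D s, (∀ s : C, a s = c s) → ∃ l ∈ L.label i j, ∀ s : l.1, a s = l.2 s

/-- The context-specific graph: the edges that are absent given `C = c` are deleted. -/
def LDAG.contextGraph {V : Type u} {D : V → Type v} (L : LDAG D) (C : Set V)
    (c : ∀ s : C, D s) : Digraph V where
  Adj i j := L.Adj i j ∧ ¬ L.AbsentGiven C c i j

/-! ### Structural causal models -/

/-- A realization of the parents of `j`. -/
abbrev DAG.ParentVals {V : Type u} (G : DAG V) (D : V → Type v) (j : V) :=
  ∀ p : {p : V // G.Adj p j}, D p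

/-- The unique solution of the equations `a j = g j (a restricted to the parents of j)`. -/
noncomputable def DAG.solve {V : Type u} [Finite V] (G : DAG V) {D : V → Type v}
    (g : ∀ j, G.ParentVals D j → D j) : ∀ j, D j :=
  G.wellFounded.fix (fun j ih => g j (fun p => ih p.1 p.2))

theorem DAG.solve_eq {V : Type u} [Finite V] (G : DAG V) {D : V → Type v}
    (g : ∀ j, G.ParentVals D j → D j) (j : V) :
    G.solve g j = g j (fun p => G.solve g p.1) :=
  G.wellFounded.fix_eq _ j

theorem DAG.measurable_solve {V : Type u} [Finite V] (G : DAG V) {D : V → Type v}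
    [∀ j, MeasurableSpace (D j)] {Ω : Type*} [MeasurableSpace Ω]
    (g : Ω → ∀ j, G.ParentVals D j → D j)
    (hg : ∀ j, Measurable (fun q : Ω × G.ParentVals D j => g q.1 j q.2)) :
    Measurable (fun ω => G.solve (g ω)) := by
  refine measurable_pi_lambda _ (fun j => ?_)
  induction j using G.wellFounded.induction with
  | _ j ih =>
    have h : (fun ω => G.solve (g ω) j) = fun ω => g ω j (fun p => G.solve (g ω) p.1) :=
      funext fun ω => G.solve_eq (g ω) j
    rw [h]
    exact (hg j).comp (measurable_id.prodMk (measurable_pi_lambda _ (fun p => ih p.1 p.2)))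

/-- A structural causal model with endogenous variables `V` and causal graph `G`. Every variable
`j` has its own exogenous term with domain `E j` and law `P j`, and is the function `f j` of its
parents and of its exogenous term. The exogenous terms are mutually independent (confounding is
represented by latent variables in `V`). -/
structure SCM {V : Type u} (G : DAG V) (D : V → Type v) [∀ j, MeasurableSpace (D j)] where
  E : V → Type w
  [measE : ∀ j, MeasurableSpace (E j)]
  P : ∀ j, Measure (E j)
  [probP : ∀ j, IsProbabilityMeasure (P j)]
  f : ∀ j, G.ParentVals D j → E j → D j
  measurable_f : ∀ j, Measurable (fun q : G.ParentVals D j × E j => f j q.1 q.2)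

attribute [instance] SCM.measE SCM.probP

namespace SCM

variable {V : Type u} [Fintype V] {G : DAG V} {D : V → Type v} [∀ j, MeasurableSpace (D j)]

/-- The joint law of the exogenous terms. -/
noncomputable def exoLaw (M : SCM.{u, v, w} G D) : Measure (∀ j, M.E j) :=
  Measure.pi M.P

/-- The values of all variables as a function of the exogenous terms. -/
noncomputable def sol (M : SCM.{u, v, w} G D) (e : ∀ j, M.E j) : ∀ j, D j :=
  G.solve (fun j pa => M.f j pa (e j))

theorem measurable_sol (M : SCM.{u, v, w} G D) : Measurable M.sol :=
  G.measurable_solve (fun (e : ∀ j, M.E j) j pa => M.f j pa (e j)) (fun j =>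
    (M.measurable_f j).comp (measurable_snd.prodMk ((measurable_pi_apply j).comp measurable_fst)))

/-- The values of all variables under `do(X = x)`: the function of `X` is replaced by the
constant `x`. -/
noncomputable def solDo [DecidableEq V] (M : SCM.{u, v, w} G D) (X : V) (x : D X)
    (e : ∀ j, M.E j) : ∀ j, D j :=
  G.solve (Function.update (fun j pa => M.f j pa (e j)) X (fun _ => x))

theorem measurable_solDo [DecidableEq V] (M : SCM.{u, v, w} G D) (X : V) :
    Measurable (fun q : (∀ j, M.E j) × D X => M.solDo X q.2 q.1) := by
  refine G.measurable_solve (fun (q : (∀ j, M.E j) × D X) =>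
    Function.update (fun j pa => M.f j pa (q.1 j)) X (fun _ => q.2)) (fun j => ?_)
  by_cases h : j = X
  · subst h
    simp only [Function.update_self]
    exact measurable_snd.comp measurable_fst
  · simp only [Function.update_of_ne h]
    exact (M.measurable_f j).comp
      (measurable_snd.prodMk ((measurable_pi_apply j).comp (measurable_fst.comp measurable_fst)))

/-- The distribution `P(V)` of all variables. -/
noncomputable def law (M : SCM.{u, v, w} G D) : Measure (∀ j, D j) :=
  M.exoLaw.map M.sol

/-- The causal mechanism of `j`: the law of `j` when its parents have the values `pa`. -/
noncomputable def mechanism (M : SCM.{u, v, w} G D) (j : V) (pa : G.ParentVals D j) :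
    Measure (D j) :=
  (M.P j).map (M.f j pa)

end SCM

/-- The marginal on the variables in `S` of a distribution of all variables. -/
noncomputable def marginal {V : Type u} {D : V → Type v} [∀ j, MeasurableSpace (D j)]
    (μ : Measure (∀ j, D j)) (S : Set V) : Measure (∀ s : S, D s) :=
  μ.map (fun a (s : S) => a s)

/-- The event `C = c`. -/
def contextEvent {V : Type u} {D : V → Type v} (C : Set V) (c : ∀ s : C, D s) :
    Set (∀ j, D j) :=
  {a | ∀ s : C, a s = c s}

/-- `M` is compatible with the labeled DAG `L`: whenever the parents of `j` take values that extend
a label of `i → j`, the law of `j` does not depend on the value of `i`. -/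
def Compatible {V : Type u} [Fintype V] {D : V → Type v} [∀ j, MeasurableSpace (D j)]
    (L : LDAG D) (M : SCM.{u, v, w} L.toDAG D) : Prop :=
  ∀ i j, ∀ l ∈ L.label i j, ∀ pa pa' : L.toDAG.ParentVals D j,
    (∀ p, p.1 ≠ i → pa p = pa' p) →
    (∀ (s : l.1) (hs : L.Adj s j), pa ⟨s, hs⟩ = l.2 s) →
    M.mechanism j pa = M.mechanism j pa'

/-! ### Policies and imitability -/

/-- The policy space: stochastic mappings from the values of `PaPi` to distributions of `X`. -/
def Policy {V : Type u} (D : V → Type v) [∀ j, MeasurableSpace (D j)] (PaPi : Set V) (X : V) :=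
  {π : Kernel (∀ s : PaPi, D s) (D X) // IsMarkovKernel π}

/-- The distribution of all variables under `do(π)`: draw the action `x` from `π(· | paPi)` and let
the model evolve under `do(X = x)`. (Here `PaPi` contains no descendant of `X`, so that its value is
not affected by the action.) -/
noncomputable def SCM.lawDo {V : Type u} [Fintype V] [DecidableEq V] {G : DAG V} {D : V → Type v}
    [∀ j, MeasurableSpace (D j)] (M : SCM.{u, v, w} G D) {PaPi : Set V} {X : V}
    (π : Policy D PaPi X) : Measure (∀ j, D j) :=
  (M.exoLaw ⊗ₘ (π.1.comap (fun e (s : PaPi) => M.sol e s)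
    (measurable_pi_lambda _ (fun s => (measurable_pi_apply s.1).comp M.measurable_sol)))).map
    (fun q => M.solDo X q.2 q.1)

/-- `P(y)` is imitable with respect to the labeled DAG `L`, the policy space and the observational
distribution `PO` of the observable variables `O`. -/
def Imitable {V : Type u} [Fintype V] [DecidableEq V] {D : V → Type v}
    [∀ j, MeasurableSpace (D j)] (L : LDAG D) (PaPi : Set V) (X Y : V) (O : Set V)
    (PO : Measure (∀ s : O, D s)) : Prop :=
  ∀ M : SCM.{u, v, w} L.toDAG D, Compatible L M → marginal M.law O = PO →
    ∃ π : Policy D PaPi X, (M.lawDo π).map (fun a => a Y) = M.law.map (fun a => a Y)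

/-- `S` is a context-specific surrogate in the context `C = c`. -/
def IsContextSurrogate {V : Type u} {D : V → Type v} (L : LDAG D) (PaPi : Set V) (X Y : V)
    (O : Set V) (C : Set V) (c : ∀ s : C, D s) (S : Set V) : Prop :=
  S ⊆ O ∧ DSep (addPolicy (L.contextGraph C c) PaPi X) X Y (S ∪ C)

/-- The equation `P(S | do(π), C = c) = P(S | C = c)` has a solution `π` in every compatible model
that induces the observational distribution `PO`. -/
def SurrogateSolvable {V : Type u} [Fintype V] [DecidableEq V] {D : V → Type v}
    [∀ j, MeasurableSpace (D j)] (L : LDAG D) (PaPi : Set V) (X : V) (O : Set V)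
    (PO : Measure (∀ s : O, D s)) (C : Set V) (c : ∀ s : C, D s) (S : Set V) : Prop :=
  ∀ M : SCM.{u, v, w} L.toDAG D, Compatible L M → marginal M.law O = PO →
    ∃ π : Policy D PaPi X,
      marginal (ProbabilityTheory.cond (M.lawDo π) (contextEvent C c)) S =
        marginal (ProbabilityTheory.cond M.law (contextEvent C c)) S

end Imitation

/-! Fix a compatible model `M`. The variables in `C` are nondescendants of `X`, so a policy leaves
their values alone, and they take countably many values, so policies chosen separately for each
context glue to one measurable policy (`exists_glued_policy`). Summing over contexts, it suffices to
find for each `c` a policy that preserves the measure of every event `C = c, Y ∈ T`.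

In a fixed context, each mechanism agrees with a kernel that reads only the parents in the
context-specific graph (`contextKernel_eq_mechanism`). Hence the observational law and the law under
the policy, integrated against functions that vanish off the context, both factorize along that
graph. They use the same kernels except at `X`.

Separation of `X` and `Y` by `S` gives an ancestral set `A` and a set `B ⊆ A` with `Y ∈ B`, `X ∉ B`,
such that every family in `A` misses `B` or lies in `B ∪ S` (`DSep.exists_partition`). The
conditional law of `B` given `A \ B` is then built from the kernels of the second kind alone. It
depends only on `S`, and it is the same under both laws because the kernel of `X` is not involved
(`exists_common_kernel`). So equality of the two laws on `S` in the context implies equality on `Y`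
(`lintegral_lawDo_eq_of_partition`).

For a surrogate, equality on `S` is the solvability assumption. In the other case the policy is the
observational conditional law of `X` given `W = Z ∪ C`. It reproduces the joint law of `W` and `X`,
and `insert X W` plays the role of `S`.

Integrals of test functions replace conditional laws throughout, so contexts of probability zero
need no separate theory. -/

namespace Imitation

/-! ### Active walks and the partition induced by d-separation -/

/-- `v` is an ancestor of (or belongs to) `Z`. -/
def IsAnc {V : Type u} (G : Digraph V) (Z : Set V) (v : V) : Prop :=
  ∃ d, IsDesc G v d ∧ d ∈ Z

theorem IsAnc.of_adj {V : Type u} {G : Digraph V} {Z : Set V} {a b : V} (h : G.Adj a b)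
    (hb : IsAnc G Z b) : IsAnc G Z a := by
  obtain ⟨d, hd, hZ⟩ := hb
  exact ⟨d, Relation.ReflTransGen.head h hd, hZ⟩

/-- Vertices reached from `y` by a walk that is active given `Z`. The flag tells whether the last
edge of the walk leaves the vertex reached (this includes the trivial walk). -/
inductive ActiveReach {V : Type u} (G : Digraph V) (Z : Set V) (y : V) : Bool → V → Prop
  | refl : ActiveReach G Z y true y
  | child {d : Bool} {a b : V} : ActiveReach G Z y d a → a ∉ Z → G.Adj a b →
      ActiveReach G Z y false b
  | parent {a b : V} : ActiveReach G Z y true a → a ∉ Z → G.Adj b a → ActiveReach G Z y true b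
  | collider {a b : V} : ActiveReach G Z y false a → IsAnc G Z a → G.Adj b a →
      ActiveReach G Z y true b

theorem not_blocked_cons {V : Type u} {G : Digraph V} {Z : Set V} {a b c : V} {l : List V}
    (h : ¬ Blocked G Z (b :: c :: l)) (h₁ : G.Adj a b ∧ G.Adj c b → IsAnc G Z b)
    (h₂ : ¬ (G.Adj a b ∧ G.Adj c b) → b ∉ Z) : ¬ Blocked G Z (a :: b :: c :: l) := by
  rintro ⟨p, q, r, hinf, hb⟩
  rcases List.infix_cons_iff.1 hinf with hpre | hinf'
  · simp only [List.cons_prefix_cons] at hpre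
    obtain ⟨rfl, rfl, rfl, -⟩ := hpre
    rcases hb with hb | hb
    · exact h₂ hb.1 hb.2
    · obtain ⟨d, hd, hZ⟩ := h₁ hb.1
      exact hb.2 d hd hZ
  · exact h ⟨p, q, r, hinf', hb⟩

theorem not_blocked_of_infix {V : Type u} {G : Digraph V} {Z : Set V} {l l' : List V}
    (h : ¬ Blocked G Z l) (hl : l' <:+: l) : ¬ Blocked G Z l' :=
  fun ⟨p, q, r, hinf, hb⟩ => h ⟨p, q, r, hinf.trans hl, hb⟩

theorem IsPath.suffix {V : Type u} {G : Digraph V} {x y a : V} {p t : List V}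
    (h : IsPath G x y (p ++ a :: t)) : IsPath G a y (a :: t) := by
  obtain ⟨h1, -, h3, h4⟩ := h
  refine ⟨(List.nodup_append.1 h1).2.1, rfl, ?_, (List.isChain_append.1 h4).2.1⟩
  simpa using h3

theorem IsPath.cons {V : Type u} {G : Digraph V} {x y a : V} {l : List V}
    (h : IsPath G x y l) (ha : a ∉ l) (hadj : G.Adj a x ∨ G.Adj x a) :
    IsPath G a y (a :: l) := by
  obtain ⟨h1, h2, h3, h4⟩ := h
  cases l with
  | nil => simp at h2
  | cons b t =>
    obtain rfl : b = x := by simpa using h2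
    exact ⟨List.nodup_cons.2 ⟨ha, h1⟩, rfl, by simpa using h3,
      List.isChain_cons_cons.2 ⟨hadj, h4⟩⟩

/-- Along an unblocked path, the property that an edge pointing into the head of the path comes
with an ancestor of `Z` passes to the rest of the path. -/
theorem head_isAnc_of_suffix {V : Type u} {G : Digraph V} {Z : Set V} (p : List V) :
    ∀ (a b : V) (t l : List V), a :: l = p ++ b :: t →
      (a :: l).IsChain (fun a b => G.Adj a b ∨ G.Adj b a) → ¬ Blocked G Z (a :: l) →
      (∀ q s, l = q :: s → G.Adj q a → IsAnc G Z a) →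
      ∀ q s, t = q :: s → G.Adj q b → IsAnc G Z b := by
  induction p with
  | nil =>
    intro a b t l h _ _ hQ
    obtain ⟨rfl, rfl⟩ : a = b ∧ l = t := by simpa using h
    exact hQ
  | cons a' p ih =>
    intro a b t l h hchain hnb hQ
    obtain ⟨rfl, hl⟩ : a = a' ∧ l = p ++ b :: t := by simpa using h
    cases l with
    | nil => simp at hl
    | cons m l =>
      refine ih m b t l hl (List.isChain_cons_cons.1 hchain).2
        (not_blocked_of_infix hnb (List.suffix_cons _ _).isInfix) ?_
      rintro q s rfl hqm
      -- If `a → m ← q`, then `m` is a collider on an unblocked path; if `m → a`, the property at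
      -- `a` passes up to its parent `m`.
      rcases (List.isChain_cons_cons.1 hchain).1 with ham | hma
      · by_contra hcon
        exact hnb ⟨a, m, q, ⟨[], s, rfl⟩, Or.inr ⟨⟨ham, hqm⟩, fun d hd hZ => hcon ⟨d, hd, hZ⟩⟩⟩
      · exact (hQ m (q :: s) rfl hma).of_adj hma

/-- An active walk can be replaced by an unblocked path. -/
theorem ActiveReach.exists_path {V : Type u} {G : Digraph V} {Z : Set V} {y : V}
    (hasymm : ∀ a b, G.Adj a b → ¬ G.Adj b a) (hy : y ∉ Z) {d : Bool} {a : V}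
    (h : ActiveReach G Z y d a) :
    ∃ t, IsPath G a y (a :: t) ∧ ¬ Blocked G Z (a :: t) ∧
      (d = true → ∀ b s, t = b :: s → G.Adj b a → IsAnc G Z a) ∧
      (d = false → (t = [] ∨ ∃ b s, t = b :: s ∧ G.Adj a b) → a ∉ Z) := by
  -- Cutting a walk at a repeated vertex may leave a path whose first edge points the other way than
  -- the last edge of the walk. The last two clauses of the goal record what is then needed to
  -- extend the path through `a`.
  classical
  have hirr : ∀ a, ¬ G.Adj a a := fun a h => hasymm a a h h
  -- Moving from `v` to a parent `b`: prepend `b` if it is new, otherwise keep the part of the path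
  -- that starts at `b`. The last two hypotheses keep `v` open as a collider and as a non-collider
  -- respectively.
  have up : ∀ (v b : V) (t : List V), G.Adj b v → IsPath G v y (v :: t) →
      ¬ Blocked G Z (v :: t) → (∀ q s, t = q :: s → G.Adj q v → IsAnc G Z v) →
      (∀ q s, t = q :: s → G.Adj v q → v ∉ Z) →
      ∃ t, IsPath G b y (b :: t) ∧ ¬ Blocked G Z (b :: t) ∧
        (∀ q s, t = q :: s → G.Adj q b → IsAnc G Z b) := by
    intro v b t hbv hp hnb hin hout
    by_cases hmem : b ∈ v :: t
    · obtain ⟨p, s, hps⟩ := List.append_of_mem hmem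
      refine ⟨s, (hps ▸ hp).suffix, not_blocked_of_infix hnb ⟨p, [], by simp [hps]⟩, ?_⟩
      exact head_isAnc_of_suffix p v b s t hps hp.2.2.2 hnb hin
    · refine ⟨v :: t, hp.cons hmem (Or.inl hbv), ?_, ?_⟩
      · cases t with
        | nil =>
          rintro ⟨p, q, r, hinf, -⟩
          have := hinf.length_le
          simp at this
        | cons q s =>
          refine not_blocked_cons hnb (fun h => hin q s rfl h.2) (fun h => ?_)
          refine hout q s rfl ?_
          rcases (List.isChain_cons_cons.1 hp.2.2.2).1 with h' | h'
          · exact h'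
          · exact absurd ⟨hbv, h'⟩ h
      · rintro q s hq hqb
        obtain ⟨rfl, rfl⟩ : v = q ∧ t = s := by simpa using hq
        exact absurd hqb (hasymm _ _ hbv)
  induction h with
  | refl =>
    refine ⟨[], ⟨by simp, rfl, rfl, by simp⟩, ?_, by simp, by simp⟩
    rintro ⟨p, q, r, hinf, -⟩
    have := hinf.length_le
    simp at this
  | @child d v b hv hvZ hvb ih =>
    obtain ⟨t, hp, hnb, -, -⟩ := ih
    by_cases hmem : b ∈ v :: t
    · obtain ⟨p, s, hps⟩ := List.append_of_mem hmem
      refine ⟨s, (hps ▸ hp).suffix, not_blocked_of_infix hnb ⟨p, [], by simp [hps]⟩, by simp, ?_⟩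
      rintro - (rfl | ⟨q, s, rfl, hbq⟩)
      · have h3 := hp.2.2.1
        rw [hps] at h3
        obtain rfl : b = y := by simpa using h3
        exact hy
      · intro hbZ
        -- Since `b ≠ v`, the vertex `b` has a predecessor on the old unblocked path, where it is a
        -- non-collider because `b → q`.
        rcases List.eq_nil_or_concat p with rfl | ⟨p', r, rfl⟩
        · obtain ⟨rfl, -⟩ : v = b ∧ _ := by simpa using hps
          exact hirr _ hvb
        · exact hnb ⟨r, b, q, ⟨p', s, by simp [hps]⟩,
            Or.inl ⟨fun h => hasymm _ _ hbq h.2, hbZ⟩⟩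
    · refine ⟨v :: t, hp.cons hmem (Or.inr hvb), ?_, by simp, ?_⟩
      · cases t with
        | nil =>
          rintro ⟨p, q, r, hinf, -⟩
          have := hinf.length_le
          simp at this
        | cons q s =>
          exact not_blocked_cons hnb (fun h => absurd h.1 (hasymm _ _ hvb)) (fun _ => hvZ)
      · rintro - (h | ⟨q, s, hq, hbq⟩)
        · simp at h
        · obtain ⟨rfl, rfl⟩ : v = q ∧ t = s := by simpa using hq
          exact absurd hbq (hasymm _ _ hvb)
  | @parent v b hv hvZ hbv ih =>
    obtain ⟨t, hp, hnb, h1, -⟩ := ih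
    obtain ⟨t', hp', hnb', h'⟩ := up v b t hbv hp hnb (h1 rfl) (fun _ _ _ _ => hvZ)
    exact ⟨t', hp', hnb', fun _ => h', by simp⟩
  | @collider v b hv hvZ hbv ih =>
    obtain ⟨t, hp, hnb, -, h2⟩ := ih
    obtain ⟨t', hp', hnb', h'⟩ := up v b t hbv hp hnb (fun _ _ _ _ => hvZ)
      (fun q s hq hvq => h2 rfl (Or.inr ⟨q, s, hq, hvq⟩))
    exact ⟨t', hp', hnb', fun _ => h', by simp⟩

/-- If `x` and `y` are d-separated by `Z`, then the ancestors of `x`, `y` and `Z` contain a set `B`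
with `y ∈ B` and `x ∉ B` such that the family of every such ancestor misses `B` or is
contained in `B ∪ Z`. -/
theorem DSep.exists_partition {V : Type u} {G : Digraph V} {x y : V} {Z : Set V}
    (hasymm : ∀ a b, G.Adj a b → ¬ G.Adj b a) (h : DSep G x y Z) :
    ∃ A B : Set V, (∀ i j, G.Adj i j → j ∈ A → i ∈ A) ∧ Z ⊆ A ∧ x ∈ A ∧ y ∈ B ∧ B ⊆ A ∧
      Disjoint B Z ∧ x ∉ B ∧ ∀ n ∈ A, (n ∉ B ∧ ∀ p, G.Adj p n → p ∉ B) ∨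
        (n ∈ B ∪ Z ∧ ∀ p, G.Adj p n → p ∈ B ∪ Z) := by
  obtain ⟨hxZ, hyZ, hsep⟩ := h
  have hx : ∀ d, ¬ ActiveReach G Z y d x := fun d hd => by
    obtain ⟨t, hp, hnb, -⟩ := hd.exists_path hasymm hyZ
    exact hnb (hsep _ hp)
  -- `A` consists of the ancestors of `x`, `y` and `Z`; `B` consists of the vertices of `A` outside
  -- `Z` that an active walk from `y` reaches.
  refine ⟨{a | IsAnc G (insert x (insert y Z)) a},
    {a | IsAnc G (insert x (insert y Z)) a ∧ a ∉ Z ∧ ∃ d, ActiveReach G Z y d a},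
    fun i j hij hj => IsAnc.of_adj hij hj, fun z hz => ⟨z, .refl, by simp [hz]⟩,
    ⟨x, .refl, by simp⟩, ⟨⟨y, .refl, by simp⟩, hyZ, true, .refl⟩, fun a ha => ha.1,
    Set.disjoint_left.2 fun a ha => ha.2.1, fun ⟨_, _, d, hd⟩ => hx d hd, ?_⟩
  intro n hn
  by_cases hcase : n ∉ {a | IsAnc G (insert x (insert y Z)) a ∧ a ∉ Z ∧ ∃ d, ActiveReach G Z y d a}
      ∧ ∀ p, G.Adj p n →
        p ∉ {a | IsAnc G (insert x (insert y Z)) a ∧ a ∉ Z ∧ ∃ d, ActiveReach G Z y d a}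
  · exact Or.inl hcase
  right
  -- A family that meets `B` has a reached head. If the head lies in `Z`, it is reached from a
  -- parent, so the walk can continue through it as a collider.
  have key : n ∈ Z ∧ ActiveReach G Z y false n ∨ n ∉ Z ∧ ∃ d, ActiveReach G Z y d n := by
    rw [not_and_or] at hcase
    rcases hcase with hc | hc
    · obtain ⟨-, h1, h2⟩ := not_not.1 hc
      exact Or.inr ⟨h1, h2⟩
    · push Not at hc
      obtain ⟨m, hmn, -, hmZ, d, hd⟩ := hc
      have := hd.child hmZ hmn
      by_cases hnZ : n ∈ Z
      · exact Or.inl ⟨hnZ, this⟩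
      · exact Or.inr ⟨hnZ, _, this⟩
  constructor
  · rcases key with hk | hk
    · exact Or.inr hk.1
    · exact Or.inl ⟨hn, hk⟩
  intro p hpn
  by_cases hpZ : p ∈ Z
  · exact Or.inr hpZ
  refine Or.inl ⟨IsAnc.of_adj hpn hn, hpZ, true, ?_⟩
  rcases key with ⟨hnZ, hr⟩ | ⟨hnZ, d, hr⟩
  · exact hr.collider ⟨n, .refl, hnZ⟩ hpn
  by_cases hanc : IsAnc G Z n
  · cases d
    · exact hr.collider hanc hpn
    · exact hr.parent hnZ hpn
  have hdesc : ∀ b, IsDesc G n b → b ∉ Z := fun b hb hbZ => hanc ⟨b, hb, hbZ⟩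
  obtain ⟨e, hne, he⟩ := hn
  rcases he with rfl | rfl | he
  -- No descendant of `n` is in `Z`, so the walk could run down from `n` to `x`.
  · exfalso
    have : ∀ b, IsDesc G n b → ∃ d, ActiveReach G Z y d b := by
      intro b hb
      induction hb with
      | refl => exact ⟨d, hr⟩
      | tail hb hbc ih =>
        obtain ⟨d', hd'⟩ := ih
        exact ⟨false, hd'.child (hdesc _ hb) hbc⟩
    obtain ⟨d', hd'⟩ := this _ hne
    exact hx d' hd'
  -- Here `e` is `y`: a directed path from `n` to `y` avoids `Z`, and walking it backwards reaches
  -- `n` with the flag `true`, from which a parent of `n` can be entered.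
  · have : ActiveReach G Z e true n := by
      have hind : ∀ b, IsDesc G b e → IsDesc G n b → ActiveReach G Z e true b := by
        intro b hb
        induction hb using Relation.ReflTransGen.head_induction_on with
        | refl => exact fun _ => .refl
        | head hbc _ ih =>
          intro hnb
          have hnc := Relation.ReflTransGen.tail hnb hbc
          exact (ih hnc).parent (hdesc _ hnc) hbc
      exact hind n hne .refl
    exact this.parent hnZ hpn
  · exact absurd he (hdesc _ hne)

/-! ### Functions of finitely many coordinates and local kernels -/

/-- The values of `b` on `B` and the values of `a` elsewhere. -/
noncomputable def override {V : Type u} {D : V → Type v} (B : Set V) (b a : ∀ j, D j) :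
    ∀ j, D j := by
  classical exact fun j => if j ∈ B then b j else a j

theorem override_of_mem {V : Type u} {D : V → Type v} {B : Set V} (b a : ∀ j, D j) {j : V}
    (h : j ∈ B) : override B b a j = b j := by
  simp [override, h]

theorem override_of_notMem {V : Type u} {D : V → Type v} {B : Set V} (b a : ∀ j, D j) {j : V}
    (h : j ∉ B) : override B b a j = a j := by
  simp [override, h]

theorem measurable_override {V : Type u} {D : V → Type v} [∀ j, MeasurableSpace (D j)]
    (B : Set V) :
    Measurable (fun q : (∀ j, D j) × (∀ j, D j) => override B q.1 q.2) := by
  refine measurable_pi_lambda _ fun j => ?_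
  by_cases h : j ∈ B
  · simp only [override_of_mem _ _ h]; fun_prop
  · simp only [override_of_notMem _ _ h]; fun_prop

theorem measurable_update_pair {V : Type u} [DecidableEq V] {D : V → Type v}
    [∀ j, MeasurableSpace (D j)] (n : V) :
    Measurable (fun q : (∀ j, D j) × D n => Function.update q.1 n q.2) := by
  refine measurable_pi_lambda _ fun j => ?_
  by_cases h : j = n
  · subst h; simp only [Function.update_self]; fun_prop
  · simp only [Function.update_of_ne h]; fun_prop

theorem override_update_of_mem {V : Type u} [DecidableEq V] {D : V → Type v} {B : Set V} {n : V}
    (h : n ∈ B) (b a : ∀ j, D j) (x : D n) :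
    override B (Function.update b n x) a = Function.update (override B b a) n x := by
  funext j
  by_cases hj : j = n
  · subst hj; simp [override_of_mem _ _ h]
  · by_cases hB : j ∈ B <;> simp [override, hj, hB]

theorem override_update_of_notMem {V : Type u} [DecidableEq V] {D : V → Type v} {B : Set V}
    {n : V} (h : n ∉ B) (b a : ∀ j, D j) (x : D n) :
    override B b (Function.update a n x) = Function.update (override B b a) n x := by
  funext j
  by_cases hj : j = n
  · subst hj; simp [override_of_notMem _ _ h]
  · by_cases hB : j ∈ B <;> simp [override, hj, hB]

/-- Nonnegative measurable functions that depend only on the variables in `W` and vanish unless the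
variables in `W ∩ C` agree with the context `c`. -/
structure IsTest {V : Type u} {D : V → Type v} [∀ j, MeasurableSpace (D j)] (C : Set V)
    (c : ∀ s : C, D s) (W : Set V) (f : (∀ j, D j) → ENNReal) : Prop where
  measurable : Measurable f
  dependsOn : DependsOn f W
  support : ∀ a, f a ≠ 0 → ∀ s : C, s.1 ∈ W → a s = c s

theorem IsTest.mono {V : Type u} {D : V → Type v} [∀ j, MeasurableSpace (D j)] {C : Set V}
    {c : ∀ s : C, D s} {W W' : Set V} {f : (∀ j, D j) → ENNReal} (hf : IsTest C c W f)
    (h : W ⊆ W') (hC : ∀ s ∈ C, s ∈ W' → s ∈ W) : IsTest C c W' f :=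
  ⟨hf.measurable, hf.dependsOn.mono h, fun a ha s hs => hf.support a ha s (hC s s.2 hs)⟩

theorem exists_ne_zero_of_lintegral_ne_zero {α : Type*} [MeasurableSpace α] {μ : Measure α}
    {f : α → ENNReal} (h : ∫⁻ x, f x ∂μ ≠ 0) : ∃ x, f x ≠ 0 := by
  by_contra! hcon
  exact h (by simp [hcon])

theorem measurable_lintegral_update {V : Type u} [DecidableEq V] {D : V → Type v}
    [∀ j, MeasurableSpace (D j)] {n : V} (k : Kernel (∀ j, D j) (D n)) [IsSFiniteKernel k]
    {f : (∀ j, D j) → ENNReal} (hf : Measurable f) :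
    Measurable (fun a => ∫⁻ x, f (Function.update a n x) ∂k a) :=
  Measurable.lintegral_kernel_prod_right (f := fun a x => f (Function.update a n x))
    (hf.comp (measurable_update_pair n))

theorem measurable_lintegral_override {V : Type u} {D : V → Type v}
    [∀ j, MeasurableSpace (D j)] (B : Set V) (k : Kernel (∀ j, D j) (∀ j, D j))
    [IsSFiniteKernel k] {f : (∀ j, D j) → ENNReal} (hf : Measurable f) :
    Measurable (fun a => ∫⁻ b, f (override B b a) ∂k a) :=
  Measurable.lintegral_kernel_prod_right (f := fun a b => f (override B b a))
    (hf.comp ((measurable_override B).comp measurable_swap))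

theorem IsTest.lintegral_update {V : Type u} [DecidableEq V] {D : V → Type v}
    [∀ j, MeasurableSpace (D j)] {C : Set V} {c : ∀ s : C, D s} {W : Set V} {n : V}
    {f : (∀ j, D j) → ENNReal} (hf : IsTest C c (insert n W) f) (hn : n ∉ W)
    (k : Kernel (∀ j, D j) (D n)) [IsSFiniteKernel k] (hk : DependsOn (fun a => k a) W) :
    IsTest C c W (fun a => ∫⁻ x, f (Function.update a n x) ∂k a) := by
  refine ⟨measurable_lintegral_update k hf.measurable, fun a a' h => ?_, fun a ha s hs => ?_⟩
  · have hk' : k a = k a' := hk h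
    simp only [hk']
    refine lintegral_congr fun x => hf.dependsOn fun j hj => ?_
    by_cases hjn : j = n
    · subst hjn; simp
    · simpa [hjn] using h j (hj.resolve_left hjn)
  · obtain ⟨x, hx⟩ := exists_ne_zero_of_lintegral_ne_zero ha
    have hsn : s.1 ≠ n := fun h => hn (h ▸ hs)
    simpa [hsn] using hf.support _ hx s (Or.inr hs)

theorem IsTest.lintegral_override {V : Type u} {D : V → Type v}
    [∀ j, MeasurableSpace (D j)] {C : Set V} {c : ∀ s : C, D s} {W B : Set V}
    {f : (∀ j, D j) → ENNReal} (hf : IsTest C c W f) (k : Kernel (∀ j, D j) (∀ j, D j)) [IsSFiniteKernel k]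
    (hk : DependsOn (fun a => k a) (W \ B)) :
    IsTest C c (W \ B) (fun a => ∫⁻ b, f (override B b a) ∂k a) := by
  refine ⟨measurable_lintegral_override B k hf.measurable, fun a a' h => ?_, fun a ha s hs => ?_⟩
  · have hk' : k a = k a' := hk h
    simp only [hk']
    refine lintegral_congr fun x => hf.dependsOn fun j hj => ?_
    by_cases hjB : j ∈ B
    · simp [override_of_mem _ _ hjB]
    · simpa [override_of_notMem _ _ hjB] using h j ⟨hj, hjB⟩
  · obtain ⟨x, hx⟩ := exists_ne_zero_of_lintegral_ne_zero ha
    rw [← hf.support _ hx s hs.1, override_of_notMem _ _ hs.2]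

/-! ### Local Markov property and conditional kernels shared by several laws. -/

/-- `μ` satisfies the Markov condition relative to the DAG `H` and the local kernel `k` at the
vertex `n`, as far as test functions for the context `c` are concerned. -/
def LocalStep {V : Type u} [DecidableEq V] {D : V → Type v} [∀ j, MeasurableSpace (D j)]
    (H : Digraph V) (C : Set V) (c : ∀ s : C, D s) (μ : Measure (∀ j, D j)) (n : V)
    (k : Kernel (∀ j, D j) (D n)) : Prop :=
  ∀ W : Set V, (∀ p q, H.Adj p q → q ∈ W → p ∈ W) → n ∉ W →
    (∀ p, H.Adj p n → p ∈ W) → ∀ f : (∀ j, D j) → ENNReal, IsTest C c (insert n W) f →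
    ∫⁻ a, f a ∂μ = ∫⁻ a, ∫⁻ x, f (Function.update a n x) ∂k a ∂μ

/-- A nonempty ancestral set has a vertex with no child in it, and removing that vertex leaves an
ancestral set. This is induction along a topological order without choosing one. -/
theorem ancestral_induction {V : Type u} [Finite V] {H : Digraph V}
    (hH : ∀ a, ¬ Relation.TransGen H.Adj a a) {P : Set V → Prop} (empty : P ∅)
    (insert : ∀ (W : Set V) (n : V), (∀ p q, H.Adj p q → q ∈ W → p ∈ W) → n ∉ W →
      (∀ p, H.Adj p n → p ∈ W) → P W → P (insert n W)) : P Set.univ := by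
  have hwf : WellFounded (fun a b => H.Adj b a) := by
    have : Std.Irrefl (Relation.TransGen (fun a b => H.Adj b a)) :=
      ⟨fun a h => hH a (by
        have := Relation.transGen_swap (r := H.Adj) (a := a) (b := a)
        exact this.1 h)⟩
    exact Subrelation.wf (r := Relation.TransGen (fun a b => H.Adj b a))
      (fun {a b} h => Relation.TransGen.single (r := fun a b => H.Adj b a) h)
      (Finite.wellFounded_of_trans_of_irrefl _)
  have main : ∀ (m : ℕ) (W : Set V), W.ncard = m → (∀ p q, H.Adj p q → q ∈ W → p ∈ W) → P W := by
    intro m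
    induction m with
    | zero =>
      intro W hW _
      rw [(Set.ncard_eq_zero W.toFinite).1 hW]
      exact empty
    | succ m ih =>
      intro W hW hdc
      have hne : W.Nonempty := by
        rw [← Set.ncard_pos W.toFinite]; omega
      obtain ⟨n, hn, hmin⟩ := hwf.has_min W hne
      have h1 := insert (W \ {n}) n
        (fun p q hpq hq => ⟨hdc p q hpq hq.1, fun h => hmin q hq.1 (by
          obtain rfl : p = n := h
          exact hpq)⟩) (by simp)
        (fun p hp => ⟨hdc p n hp hn, fun h => hH n (Relation.TransGen.single (by
          obtain rfl : p = n := h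
          exact hp))⟩)
      rw [Set.insert_sdiff_singleton, Set.insert_eq_of_mem hn] at h1
      refine h1 (ih _ ?_ ?_)
      · rw [Set.ncard_sdiff_singleton_of_mem hn, hW]; rfl
      · exact fun p q hpq hq => ⟨hdc p q hpq hq.1, fun h => hmin q hq.1 (by
          obtain rfl : p = n := h
          exact hpq)⟩
  exact main _ _ rfl (fun _ _ _ _ => trivial)

/-- If the families of the vertices in `A` miss `B` or are contained in `B ∪ S`, then the
conditional law of the variables in `B` given those in `A \ B` depends only on the variables in `S`,
and is the same for all models that share the mechanisms of the families of the second kind. -/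
theorem exists_common_kernel {V : Type u} [Finite V] [DecidableEq V] {D : V → Type v}
    [∀ j, MeasurableSpace (D j)] [∀ j, StandardBorelSpace (D j)] [∀ j, Nonempty (D j)]
    {ι : Type*} [Nonempty ι] {H K : Digraph V} (hH : ∀ a, ¬ Relation.TransGen H.Adj a a)
    (hKH : ∀ i j, K.Adj i j → H.Adj i j) {A B S C : Set V} {c : ∀ s : C, D s} (hCS : C ⊆ S)
    (hSA : S ⊆ A) (hBS : Disjoint B S) (hA : ∀ i j, K.Adj i j → j ∈ A → i ∈ A)
    (μ : ι → Measure (∀ j, D j)) (k : ι → ∀ n, Kernel (∀ j, D j) (D n))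
    [∀ i n, IsMarkovKernel (k i n)]
    (hk : ∀ i n, DependsOn (fun a => k i n a) {p | K.Adj p n})
    (hstep : ∀ i n, LocalStep H C c (μ i) n (k i n))
    (hfam : ∀ n ∈ A, (n ∉ B ∧ ∀ p, K.Adj p n → p ∉ B) ∨
      (n ∈ B ∪ S ∧ (∀ p, K.Adj p n → p ∈ B ∪ S) ∧ ∀ i j, k i n = k j n)) :
    ∃ κ : Kernel (∀ j, D j) (∀ j, D j), IsMarkovKernel κ ∧ DependsOn (fun a => κ a) S ∧
      ∀ i f, IsTest C c A f → ∫⁻ a, f a ∂μ i = ∫⁻ a, ∫⁻ b, f (override B b a) ∂κ a ∂μ i := by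
  have hCA : C ⊆ A := hCS.trans hSA
  have hCB : ∀ s ∈ C, s ∉ B := fun s hs hB => Set.disjoint_left.1 hBS hB (hCS hs)
  obtain ⟨i₀⟩ := ‹Nonempty ι›
  let a₀ : ∀ j, D j := fun j => Classical.arbitrary _
  suffices hmain : ∃ κ : Kernel (∀ j, D j) (∀ j, D j), IsMarkovKernel κ ∧
      DependsOn (fun a => κ a) (S ∩ Set.univ) ∧ ∀ i f, IsTest C c (A ∩ Set.univ) f →
        ∫⁻ a, f a ∂μ i = ∫⁻ a, ∫⁻ b, f (override B b a) ∂κ a ∂μ i by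
    simpa only [Set.inter_univ] using hmain
  -- The order comes from the large graph `H`, while families are taken in `K`. At stage `W`, `κ` is
  -- the conditional law of `B ∩ W` given `S ∩ W`; its other coordinates are irrelevant.
  refine ancestral_induction hH (P := fun W => ∃ κ : Kernel (∀ j, D j) (∀ j, D j),
    IsMarkovKernel κ ∧ DependsOn (fun a => κ a) (S ∩ W) ∧ ∀ i f, IsTest C c (A ∩ W) f →
      ∫⁻ a, f a ∂μ i = ∫⁻ a, ∫⁻ b, f (override B b a) ∂κ a ∂μ i) ?_ ?_
  · refine ⟨Kernel.const _ (Measure.dirac a₀), inferInstance, fun _ _ _ => rfl, fun i f hf => ?_⟩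
    have h : ∀ a b, f (override B b a) = f a := fun a b => hf.dependsOn (by simp)
    simp [h]
  intro W n hW hnW hpaW ⟨κ, hκ, hκS, hκf⟩
  by_cases hnA : n ∉ A
  · have hAW : A ∩ insert n W = A ∩ W := Set.inter_insert_of_notMem hnA
    refine ⟨κ, hκ, hκS.mono (by gcongr; simp), fun i f hf => hκf i f ?_⟩
    rwa [hAW] at hf
  rw [not_not] at hnA
  have hAW : A ∩ insert n W = insert n (A ∩ W) := Set.inter_insert_of_mem hnA
  have hnAW : n ∉ A ∩ W := fun h => hnW h.2
  have hpa : {p | K.Adj p n} ⊆ A ∩ W := fun p hp => ⟨hA p n hp hnA, hpaW p (hKH _ _ hp)⟩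
  have hstep' : ∀ i f, IsTest C c (insert n (A ∩ W)) f →
      ∫⁻ a, f a ∂μ i = ∫⁻ a, ∫⁻ x, f (Function.update a n x) ∂k i n a ∂μ i := fun i f hf =>
    hstep i n W hW hnW hpaW f (hf.mono (by gcongr; simp) fun s hs hsW =>
      hsW.imp id fun h => ⟨hCA hs, h⟩)
  have hind : ∀ i f, IsTest C c (insert n (A ∩ W)) f → ∫⁻ a, f a ∂μ i =
      ∫⁻ a, ∫⁻ b, ∫⁻ x, f (Function.update (override B b a) n x)
        ∂k i n (override B b a) ∂κ a ∂μ i := fun i f hf => by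
    rw [hstep' i f hf]
    exact hκf i _ (hf.lintegral_update hnAW (k i n) ((hk i n).mono hpa))
  simp only [hAW]
  have hκn : ∀ a x, κ (Function.update a n x) = κ a := fun a x => hκS fun j hj => by
    have : j ≠ n := fun h => hnW (h ▸ hj.2)
    simp [this]
  rcases hfam n hnA with ⟨hnB, hpB⟩ | ⟨hnBS, hpBS, hkk⟩
  -- The family misses `B`: drawing coordinate `n` and drawing the `B`-coordinates do not interact,
  -- so `κ` survives and Tonelli exchanges the two integrals.
  · refine ⟨κ, hκ, hκS.mono (by gcongr; simp), fun i f hf => ?_⟩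
    have hki : ∀ a b, k i n (override B b a) = k i n a := fun a b => hk i n fun p hp =>
      override_of_notMem _ _ (hpB p hp)
    have hg : IsTest C c (insert n (A ∩ W)) (fun a => ∫⁻ b, f (override B b a) ∂κ a) := by
      refine (hf.lintegral_override (B := B) κ (hκS.mono ?_)).mono Set.sdiff_subset
        fun s hs h => ⟨h, hCB s hs⟩
      exact fun s hs => ⟨Or.inr ⟨hSA hs.1, hs.2⟩, fun h => Set.disjoint_left.1 hBS h hs.1⟩
    rw [hind i f hf, hstep' i _ hg]
    refine lintegral_congr fun a => ?_
    simp only [hki, hκn, override_update_of_notMem hnB]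
    refine lintegral_lintegral_swap (Measurable.aemeasurable ?_)
    exact hf.measurable.comp ((measurable_update_pair n).comp
      (((measurable_override B).comp (measurable_fst.prodMk measurable_const)).prodMk
        measurable_snd))
  -- The family lies in `B ∪ S`. Masking all coordinates outside `S ∩ W` makes `lam`, the joint law
  -- of the `B`-coordinates and coordinate `n`, depend on `S ∩ W` only; the shared kernel makes it
  -- independent of `i`.
  · let mask : (∀ j, D j) → ∀ j, D j := fun a => override (S ∩ W) a a₀
    have hmask : Measurable mask :=
      (measurable_override (S ∩ W)).comp (measurable_id.prodMk measurable_const)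
    have hmaskS : ∀ a, ∀ j ∈ S ∩ W, mask a j = a j := fun a j hj => override_of_mem _ _ hj
    have hmask_dep : ∀ a a', (∀ j ∈ S ∩ W, a j = a' j) → mask a = mask a' := fun a a' h => by
      funext j
      by_cases hj : j ∈ S ∩ W
      · rw [hmaskS a j hj, hmaskS a' j hj, h j hj]
      · simp only [mask, override_of_notMem _ _ hj]
    have hκmask : ∀ a, κ (mask a) = κ a := fun a => hκS (hmaskS a)
    have hkmask : ∀ i a b, k i₀ n (override B b (mask a)) = k i n (override B b a) := by
      intro i a b
      rw [hkk i₀ i]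
      refine hk i n fun p hp => ?_
      by_cases hpB : p ∈ B
      · simp [override_of_mem _ _ hpB]
      · rw [override_of_notMem _ _ hpB, override_of_notMem _ _ hpB]
        exact hmaskS a p ⟨(hpBS p hp).resolve_left hpB, (hpa hp).2⟩
    let lam : Kernel (∀ j, D j) ((∀ j, D j) × D n) :=
      κ ⊗ₖ (k i₀ n).comap (fun q => override B q.2 q.1) ((measurable_override B).comp measurable_swap)
    have hlam : ∀ i f, IsTest C c (insert n (A ∩ W)) f → ∫⁻ a, f a ∂μ i =
        ∫⁻ a, ∫⁻ q, f (Function.update (override B q.1 a) n q.2) ∂lam (mask a) ∂μ i := by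
      intro i f hf
      rw [hind i f hf]
      refine lintegral_congr fun a => ?_
      rw [Kernel.lintegral_compProd]
      · simp only [Kernel.comap_apply, hκmask, hkmask i]
      · exact hf.measurable.comp ((measurable_update_pair n).comp
          (((measurable_override B).comp (measurable_fst.prodMk measurable_const)).prodMk
            measurable_snd))
    by_cases hnB : n ∈ B
    · refine ⟨(lam.comap mask hmask).map (fun q => Function.update q.1 n q.2),
        Kernel.IsMarkovKernel.map _ (measurable_update_pair n), fun a a' h => ?_, fun i f hf => ?_⟩
      · have : mask a = mask a' := hmask_dep a a' fun j hj => h j ⟨hj.1, Or.inr hj.2⟩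
        simp only [Kernel.map_apply _ (measurable_update_pair n), Kernel.comap_apply, this]
      · rw [hlam i f hf]
        refine lintegral_congr fun a => ?_
        rw [Kernel.lintegral_map _ (measurable_update_pair n)]
        · simp only [Kernel.comap_apply, override_update_of_mem hnB]
        · exact hf.measurable.comp
            ((measurable_override B).comp (measurable_id.prodMk measurable_const))
    · have hnS : n ∈ S := hnBS.resolve_left hnB
      -- Now `n` joins the conditioning variables, so the new kernel is the disintegration of `lam`
      -- with respect to coordinate `n` (Bayes' rule). It is common to all `i` because `lam` is.
      let lam' : Kernel (∀ j, D j) (D n × ∀ j, D j) := lam.map Prod.swap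
      have : IsMarkovKernel lam' := Kernel.IsMarkovKernel.map _ measurable_swap
      have hmask' : Measurable fun a : ∀ j, D j => (mask a, a n) :=
        hmask.prodMk (measurable_pi_apply n)
      refine ⟨lam'.condKernel.comap (fun a => (mask a, a n)) hmask', inferInstance,
        fun a a' h => ?_, fun i f hf => ?_⟩
      · have h1 : mask a = mask a' := hmask_dep a a' fun j hj => h j ⟨hj.1, Or.inr hj.2⟩
        have h2 : a n = a' n := h n ⟨hnS, Or.inl rfl⟩
        simp only [Kernel.comap_apply, h1, h2]
      · have hg : IsTest C c (insert n (A ∩ W) \ B) (fun a => ∫⁻ b, f (override B b a)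
            ∂lam'.condKernel.comap (fun a => (mask a, a n)) hmask' a) := by
          refine hf.lintegral_override (B := B) _ fun a a' h => ?_
          have h1 : mask a = mask a' := hmask_dep a a' fun j hj =>
            h j ⟨Or.inr ⟨hSA hj.1, hj.2⟩, fun hB => Set.disjoint_left.1 hBS hB hj.1⟩
          have h2 : a n = a' n := h n ⟨Or.inl rfl, hnB⟩
          simp only [Kernel.comap_apply, h1, h2]
        rw [hlam i f hf, hlam i _ (hg.mono Set.sdiff_subset fun s hs h => ⟨h, hCB s hs⟩)]
        refine lintegral_congr fun a => ?_
        have hF : Measurable fun q : D n × (∀ j, D j) =>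
            f (override B q.2 (Function.update a n q.1)) :=
          hf.measurable.comp ((measurable_override B).comp (measurable_snd.prodMk
            ((measurable_update_pair n).comp (measurable_const.prodMk measurable_fst))))
        have hleft : ∫⁻ q, f (Function.update (override B q.1 a) n q.2) ∂lam (mask a) =
            ∫⁻ q, f (override B q.2 (Function.update a n q.1)) ∂lam' (mask a) := by
          rw [Kernel.lintegral_map _ measurable_swap _ hF]
          simp only [Prod.fst_swap, Prod.snd_swap, override_update_of_notMem hnB]
        have hmn : ∀ x, mask (Function.update a n x) = mask a := fun x =>
          hmask_dep _ _ fun j hj => by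
            have : j ≠ n := fun h => hnW (h ▸ hj.2)
            simp [this]
        have hright : ∀ q : (∀ j, D j) × D n,
            (fun a => ∫⁻ b, f (override B b a)
              ∂lam'.condKernel.comap (fun a => (mask a, a n)) hmask' a)
              (Function.update (override B q.1 a) n q.2) =
            ∫⁻ b, f (override B b (Function.update a n q.2)) ∂lam'.condKernel (mask a, q.2) := by
          intro q
          have h1 := hg.dependsOn (x := Function.update (override B q.1 a) n q.2)
            (y := Function.update a n q.2) (fun j hj => by
              by_cases hjn : j = n
              · subst hjn; simp
              · simp [hjn, override_of_notMem _ _ hj.2])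
          refine h1.trans ?_
          simp only [Kernel.comap_apply, hmn, Function.update_self]
        have hG : Measurable fun x : D n =>
            ∫⁻ b, f (override B b (Function.update a n x)) ∂lam'.condKernel (mask a, x) :=
          Measurable.lintegral_kernel_prod_right
            (κ := lam'.condKernel.comap (fun x => (mask a, x)) (by fun_prop))
            (f := fun x b => f (override B b (Function.update a n x))) hF
        rw [hleft]
        simp only [hright]
        have hfst : ∫⁻ q, (∫⁻ b, f (override B b (Function.update a n q.2))
              ∂lam'.condKernel (mask a, q.2)) ∂lam (mask a) =
            ∫⁻ x, (∫⁻ b, f (override B b (Function.update a n x))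
              ∂lam'.condKernel (mask a, x)) ∂lam'.fst (mask a) := by
          rw [Kernel.lintegral_fst _ _ hG]
          exact (Kernel.lintegral_map _ measurable_swap _ (hG.comp measurable_fst)).symm
        rw [hfst]
        conv_lhs => rw [← lam'.disintegrate lam'.condKernel]
        rw [Kernel.lintegral_compProd _ _ _ hF]

/-! ### The Markov condition for structural causal models -/

/-- By independence, the exogenous term of `n` may be redrawn while the others are kept. This is the
source of the Markov condition for structural models. -/
theorem lintegral_pi_update {V : Type u} [Fintype V] [DecidableEq V] {E : V → Type w}
    [∀ j, MeasurableSpace (E j)] (P : ∀ j, Measure (E j)) [∀ j, IsProbabilityMeasure (P j)]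
    (n : V) {F : (∀ j, E j) → ENNReal} (hF : Measurable F) :
    ∫⁻ e, F e ∂Measure.pi P = ∫⁻ e, ∫⁻ t, F (Function.update e n t) ∂P n ∂Measure.pi P := by
  refine lintegral_eq_of_lmarginal_eq {n} hF ?_ ?_
  · exact Measurable.lintegral_prod_right' (f := fun q => F (Function.update q.1 n q.2))
      (hF.comp (measurable_update_pair n))
  · simp [lmarginal_singleton]

namespace SCM

theorem measurable_f_apply {V : Type u} {G : DAG V} {D : V → Type v} [∀ j, MeasurableSpace (D j)]
    (M : SCM.{u, v, w} G D) (j : V) (pa : G.ParentVals D j) : Measurable (M.f j pa) :=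
  (M.measurable_f j).comp measurable_prodMk_left

variable {V : Type u} [Fintype V] {G : DAG V} {D : V → Type v} [∀ j, MeasurableSpace (D j)]

theorem sol_eq (M : SCM.{u, v, w} G D) (e : ∀ j, M.E j) (j : V) :
    M.sol e j = M.f j (fun p => M.sol e p.1) (e j) :=
  G.solve_eq _ j

theorem solDo_self [DecidableEq V] (M : SCM.{u, v, w} G D) (X : V) (x : D X)
    (e : ∀ j, M.E j) : M.solDo X x e X = x := by
  rw [solDo, G.solve_eq, Function.update_self]

theorem solDo_of_ne [DecidableEq V] (M : SCM.{u, v, w} G D) {X j : V} (h : j ≠ X) (x : D X)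
    (e : ∀ j, M.E j) : M.solDo X x e j = M.f j (fun p => M.solDo X x e p.1) (e j) := by
  rw [solDo, G.solve_eq, Function.update_of_ne h]

theorem sol_congr (M : SCM.{u, v, w} G D) {W : Set V}
    (hW : ∀ p q, G.Adj p q → q ∈ W → p ∈ W) {e e' : ∀ j, M.E j} (h : ∀ j ∈ W, e j = e' j)
    (j : V) (hj : j ∈ W) : M.sol e j = M.sol e' j := by
  induction j using G.wellFounded.induction with
  | _ j ih =>
    rw [M.sol_eq e, M.sol_eq e', h j hj]
    congr 1
    exact funext fun p => ih p.1 p.2 (hW _ _ p.2 hj)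

theorem solDo_congr [DecidableEq V] (M : SCM.{u, v, w} G D) {W : Set V}
    (hW : ∀ p q, G.Adj p q → q ∈ W → p ∈ W) {e e' : ∀ j, M.E j} (h : ∀ j ∈ W, e j = e' j)
    {X : V} (x : D X) (j : V) (hj : j ∈ W) : M.solDo X x e j = M.solDo X x e' j := by
  induction j using G.wellFounded.induction with
  | _ j ih =>
    by_cases hjX : j = X
    · subst hjX; rw [solDo_self, solDo_self]
    · rw [M.solDo_of_ne hjX, M.solDo_of_ne hjX, h j hj]
      congr 1
      exact funext fun p => ih p.1 p.2 (hW _ _ p.2 hj)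

theorem solDo_eq_sol [DecidableEq V] (M : SCM.{u, v, w} G D) {W : Set V}
    (hW : ∀ p q, G.Adj p q → q ∈ W → p ∈ W) {X : V} (hX : X ∉ W) (x : D X) (e : ∀ j, M.E j)
    (j : V) (hj : j ∈ W) : M.solDo X x e j = M.sol e j := by
  induction j using G.wellFounded.induction with
  | _ j ih =>
    rw [M.solDo_of_ne (by rintro rfl; exact hX hj), M.sol_eq]
    congr 1
    exact funext fun p => ih p.1 p.2 (hW _ _ p.2 hj)

instance isProbabilityMeasure_law (M : SCM.{u, v, w} G D) : IsProbabilityMeasure M.law := by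
  have : IsProbabilityMeasure M.exoLaw := by unfold exoLaw; infer_instance
  exact Measure.isProbabilityMeasure_map M.measurable_sol.aemeasurable

theorem lintegral_law (M : SCM.{u, v, w} G D) {f : (∀ j, D j) → ENNReal} (hf : Measurable f) :
    ∫⁻ a, f a ∂M.law = ∫⁻ e, f (M.sol e) ∂M.exoLaw :=
  lintegral_map hf M.measurable_sol

theorem lintegral_lawDo [DecidableEq V] (M : SCM.{u, v, w} G D) {PaPi : Set V} {X : V}
    (π : Policy D PaPi X) {f : (∀ j, D j) → ENNReal} (hf : Measurable f) :
    ∫⁻ a, f a ∂M.lawDo π =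
      ∫⁻ e, ∫⁻ x, f (M.solDo X x e) ∂π.1 (fun s => M.sol e s) ∂M.exoLaw := by
  have : IsMarkovKernel π.1 := π.2
  have : IsProbabilityMeasure M.exoLaw := by unfold exoLaw; infer_instance
  rw [lawDo, lintegral_map hf (M.measurable_solDo X),
    Measure.lintegral_compProd (f := fun q => f (M.solDo X q.2 q.1))
      (hf.comp (M.measurable_solDo X))]
  rfl

/-- An intervention on `X` cannot reach an ancestral set that does not contain `X`. -/
theorem lintegral_lawDo_of_dependsOn [DecidableEq V] (M : SCM.{u, v, w} G D) {PaPi : Set V}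
    {X : V} (π : Policy D PaPi X) {W : Set V} (hW : ∀ p q, G.Adj p q → q ∈ W → p ∈ W)
    (hX : X ∉ W) {f : (∀ j, D j) → ENNReal} (hf : Measurable f) (hfW : DependsOn f W) :
    ∫⁻ a, f a ∂M.lawDo π = ∫⁻ a, f a ∂M.law := by
  have : IsMarkovKernel π.1 := π.2
  rw [M.lintegral_lawDo π hf, M.lintegral_law hf]
  refine lintegral_congr fun e => ?_
  have h : ∀ x, f (M.solDo X x e) = f (M.sol e) := fun x =>
    hfW fun j hj => M.solDo_eq_sol hW hX x e j hj
  simp [h]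

/-- The mechanism of `j` as a Markov kernel. -/
noncomputable def mechKernel (M : SCM.{u, v, w} G D) (j : V) :
    Kernel (G.ParentVals D j) (D j) where
  toFun := M.mechanism j
  measurable' := by
    have h : M.mechanism j = fun pa => ((M.P j).map (Prod.mk pa)).map (fun q => M.f j q.1 q.2) := by
      funext pa
      rw [Measure.map_map (M.measurable_f j) measurable_prodMk_left]
      rfl
    rw [h]
    exact (Measure.measurable_map _ (M.measurable_f j)).comp Measurable.map_prodMk_left

instance isMarkovKernel_mechKernel (M : SCM.{u, v, w} G D) (j : V) :
    IsMarkovKernel (M.mechKernel j) :=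
  ⟨fun pa => Measure.isProbabilityMeasure_map (M.measurable_f_apply j pa).aemeasurable⟩

/-- Integrating a test function against the mechanism or against a kernel that agrees with it
in the context gives the same result. -/
theorem lintegral_mechanism [DecidableEq V] (M : SCM.{u, v, w} G D) {C W : Set V}
    {c : ∀ s : C, D s} {n : V} (hn : n ∉ W) (hpa : ∀ p, G.Adj p n → p ∈ W)
    {k : Kernel (∀ j, D j) (D n)} (hk : ∀ a : ∀ j, D j, (∀ s : C, G.Adj s n → a s = c s) →
      k a = M.mechanism n fun p => a p.1)
    {f : (∀ j, D j) → ENNReal} (hf : IsTest C c (insert n W) f) (a : ∀ j, D j) :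
    ∫⁻ t, f (Function.update a n (M.f n (fun p => a p.1) t)) ∂M.P n =
      ∫⁻ x, f (Function.update a n x) ∂k a := by
  have hm : Measurable fun x => f (Function.update a n x) :=
    hf.measurable.comp (measurable_update a)
  by_cases h : ∀ s : C, G.Adj s n → a s = c s
  · rw [hk a h, mechanism, lintegral_map hm (M.measurable_f_apply n _)]
  · have hzero : ∀ x, f (Function.update a n x) = 0 := by
      intro x
      by_contra hx
      refine h fun s hs => ?_
      have hsn : s.1 ≠ n := fun h => hn (h ▸ hpa _ hs)
      simpa [hsn] using hf.support _ hx s (Or.inr (hpa _ hs))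
    simp [hzero]

/-- Redrawing the exogenous term of `n` leaves the ancestral set `W` unchanged and redraws
coordinate `n` from its mechanism. -/
theorem localStep_law [DecidableEq V] (M : SCM.{u, v, w} G D) {H : Digraph V}
    (hGH : ∀ i j, G.Adj i j → H.Adj i j) {C : Set V} {c : ∀ s : C, D s} {n : V}
    {k : Kernel (∀ j, D j) (D n)} (hk : ∀ a : ∀ j, D j, (∀ s : C, G.Adj s n → a s = c s) →
      k a = M.mechanism n fun p => a p.1) [IsSFiniteKernel k] :
    LocalStep H C c M.law n k := by
  intro W hW hn hpa f hf
  rw [M.lintegral_law hf.measurable, M.lintegral_law (measurable_lintegral_update k hf.measurable),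
    exoLaw, lintegral_pi_update M.P n (F := fun e => f (M.sol e)) (hf.measurable.comp M.measurable_sol)]
  refine lintegral_congr fun e => ?_
  rw [← M.lintegral_mechanism hn (fun p hp => hpa p (hGH _ _ hp)) hk hf]
  refine lintegral_congr fun t => hf.dependsOn fun j hj => ?_
  have hsol : ∀ j ∈ W, M.sol (Function.update e n t) j = M.sol e j :=
    M.sol_congr (fun p q h => hW p q (hGH _ _ h)) fun j hj => by
      have : j ≠ n := fun h => hn (h ▸ hj)
      simp [this]
  by_cases hjn : j = n
  · subst hjn
    rw [M.sol_eq, Function.update_self, Function.update_self]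
    congr 1
    exact funext fun p => hsol _ (hpa _ (hGH _ _ p.2))
  · rw [Function.update_of_ne hjn]
    exact hsol j (hj.resolve_left hjn)

/-- If `X ∈ W`, then `PaPi ⊆ W` because `W` is ancestral for the graph with the policy edges.
Redrawing the exogenous term of `n` therefore affects neither the policy's input nor the values on
`W`. If `X ∉ W`, the intervention is invisible on `insert n W` and the observational case applies.
-/
theorem localStep_lawDo [DecidableEq V] (M : SCM.{u, v, w} G D) {PaPi : Set V} {X : V}
    (π : Policy D PaPi X) {C : Set V} {c : ∀ s : C, D s} {n : V} (hnX : n ≠ X)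
    {k : Kernel (∀ j, D j) (D n)} (hk : ∀ a : ∀ j, D j, (∀ s : C, G.Adj s n → a s = c s) →
      k a = M.mechanism n fun p => a p.1) [IsSFiniteKernel k]
    (hdep : DependsOn (fun a => k a) {p | G.Adj p n}) :
    LocalStep (addPolicy G.toDigraph PaPi X) C c (M.lawDo π) n k := by
  have hπ : IsMarkovKernel π.1 := π.2
  intro W hW hn hpa f hf
  have hGW : ∀ p q, G.Adj p q → q ∈ W → p ∈ W := fun p q h => hW p q (Or.inl h)
  have hGn : ∀ p, G.Adj p n → p ∈ W := fun p h => hpa p (Or.inl h)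
  by_cases hX : X ∈ W
  · have hPW : ∀ s ∈ PaPi, s ∈ W := fun s hs => hW s X (Or.inr ⟨hs, rfl⟩) hX
    have hmeas : Measurable fun e => ∫⁻ x, f (M.solDo X x e) ∂π.1 (fun s => M.sol e s) :=
      Measurable.lintegral_kernel_prod_right
        (κ := π.1.comap (fun e (s : PaPi) => M.sol e s) (measurable_pi_lambda _ fun s =>
          (measurable_pi_apply s.1).comp M.measurable_sol))
        (f := fun e x => f (M.solDo X x e)) (hf.measurable.comp (M.measurable_solDo X))
    rw [M.lintegral_lawDo π hf.measurable,
      M.lintegral_lawDo π (measurable_lintegral_update k hf.measurable), exoLaw,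
      lintegral_pi_update M.P n hmeas]
    refine lintegral_congr fun e => ?_
    have hupd : ∀ t, ∀ j ∈ W, Function.update e n t j = e j := fun t j hj => by
      have : j ≠ n := fun h => hn (h ▸ hj)
      simp [this]
    have hpol : ∀ t, (fun s : PaPi => M.sol (Function.update e n t) s) = fun (s : PaPi) => M.sol e s :=
      fun t => funext fun s => M.sol_congr hGW (hupd t) _ (hPW s s.2)
    have hval : ∀ t x, f (M.solDo X x (Function.update e n t)) =
        f (Function.update (M.solDo X x e) n (M.f n (fun p => M.solDo X x e p.1) t)) := by
      intro t x
      refine hf.dependsOn fun j hj => ?_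
      by_cases hjn : j = n
      · subst hjn
        rw [M.solDo_of_ne hnX, Function.update_self, Function.update_self]
        congr 1
        exact funext fun p => M.solDo_congr hGW (hupd t) x _ (hGn _ p.2)
      · rw [Function.update_of_ne hjn]
        exact M.solDo_congr hGW (hupd t) x j (hj.resolve_left hjn)
    simp only [hpol, hval, ← M.lintegral_mechanism hn hGn hk hf]
    refine lintegral_lintegral_swap (Measurable.aemeasurable ?_)
    have hs : Measurable fun q : M.E n × D X => M.solDo X q.2 e :=
      (M.measurable_solDo X).comp (measurable_const.prodMk measurable_snd)
    exact hf.measurable.comp ((measurable_update_pair n).comp (hs.prodMk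
      ((M.measurable_f n).comp ((measurable_pi_lambda _ fun p =>
        (measurable_pi_apply p.1).comp hs).prodMk measurable_fst))))
  · have hGiW : ∀ p q, G.Adj p q → q ∈ insert n W → p ∈ insert n W := by
      rintro p q h (rfl | hq)
      · exact Or.inr (hGn p h)
      · exact Or.inr (hGW p q h hq)
    have hXi : X ∉ insert n W := fun h => h.elim (fun h => hnX h.symm) hX
    have hg := hf.lintegral_update hn k (hdep.mono fun p hp => hGn p hp)
    rw [M.lintegral_lawDo_of_dependsOn π hGiW hXi hf.measurable hf.dependsOn,
      M.lintegral_lawDo_of_dependsOn π hGW hX hg.measurable hg.dependsOn]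
    exact M.localStep_law (fun _ _ h => h) hk W hGW hn hGn f hf

theorem localStep_lawDo_self [DecidableEq V] (M : SCM.{u, v, w} G D) {PaPi : Set V} {X : V}
    (π : Policy D PaPi X) {C : Set V} {c : ∀ s : C, D s} :
    LocalStep (addPolicy G.toDigraph PaPi X) C c (M.lawDo π) X
      (π.1.comap (fun a (s : PaPi) => a s) (by fun_prop)) := by
  have hπ : IsMarkovKernel π.1 := π.2
  intro W hW hX hpa f hf
  have hGW : ∀ p q, G.Adj p q → q ∈ W → p ∈ W := fun p q h => hW p q (Or.inl h)
  rw [M.lintegral_lawDo π hf.measurable,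
    M.lintegral_lawDo π (measurable_lintegral_update _ hf.measurable)]
  refine lintegral_congr fun e => ?_
  have hsol := fun x => M.solDo_eq_sol hGW hX x e
  have hpol : ∀ x, (fun s : PaPi => M.solDo X x e s) = fun (s : PaPi) => M.sol e s := fun x =>
    funext fun s => hsol x s (hpa s (Or.inr ⟨s.2, rfl⟩))
  have hval : ∀ x y, f (Function.update (M.solDo X x e) X y) = f (M.solDo X y e) := by
    intro x y
    refine hf.dependsOn fun j hj => ?_
    by_cases hjX : j = X
    · subst hjX
      rw [M.solDo_self, Function.update_self]
    · rw [Function.update_of_ne hjX, hsol x j (hj.resolve_left hjX),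
        hsol y j (hj.resolve_left hjX)]
  simp [Kernel.comap_apply, hpol, hval]

end SCM

/-! ### Mechanisms in a context -/

/-- The assignment with values `s` on `W` and `a` elsewhere. -/
noncomputable def extendBy {V : Type u} {D : V → Type v} (W : Set V) (a : ∀ j, D j)
    (s : ∀ s : W, D s) : ∀ j, D j := by
  classical exact fun j => if h : j ∈ W then s ⟨j, h⟩ else a j

theorem extendBy_of_mem {V : Type u} {D : V → Type v} {W : Set V} (a : ∀ j, D j)
    (s : ∀ s : W, D s) {j : V} (h : j ∈ W) : extendBy W a s j = s ⟨j, h⟩ := by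
  simp [extendBy, h]

theorem measurable_extendBy {V : Type u} {D : V → Type v} [∀ j, MeasurableSpace (D j)]
    (W : Set V) (a : ∀ j, D j) : Measurable (extendBy W a) := by
  refine measurable_pi_lambda _ fun j => ?_
  by_cases h : j ∈ W
  · simp only [extendBy_of_mem _ _ h]; fun_prop
  · simp only [extendBy, h, dite_false]; fun_prop

/-- The mechanism of `n`, with the parents whose edges are absent in the context `c` set to the
values of `a₀`. -/
noncomputable def contextKernel {V : Type u} [Fintype V] {D : V → Type v}
    [∀ j, MeasurableSpace (D j)] (L : LDAG D) (M : SCM.{u, v, w} L.toDAG D) (C : Set V)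
    (c : ∀ s : C, D s) (a₀ : ∀ j, D j) (n : V) : Kernel (∀ j, D j) (D n) :=
  (M.mechKernel n).comap
    (fun a p => override {p | (L.contextGraph C c).Adj p n} a a₀ p.1)
    (measurable_pi_lambda _ fun p => (measurable_pi_apply p.1).comp
      ((measurable_override _).comp (measurable_id.prodMk measurable_const)))

instance isMarkovKernel_contextKernel {V : Type u} [Fintype V] {D : V → Type v}
    [∀ j, MeasurableSpace (D j)] (L : LDAG D) (M : SCM.{u, v, w} L.toDAG D) (C : Set V)
    (c : ∀ s : C, D s) (a₀ : ∀ j, D j) (n : V) : IsMarkovKernel (contextKernel L M C c a₀ n) := by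
  unfold contextKernel; infer_instance

theorem dependsOn_contextKernel {V : Type u} [Fintype V] {D : V → Type v}
    [∀ j, MeasurableSpace (D j)] (L : LDAG D) (M : SCM.{u, v, w} L.toDAG D) (C : Set V)
    (c : ∀ s : C, D s) (a₀ : ∀ j, D j) (n : V) :
    DependsOn (fun a => contextKernel L M C c a₀ n a) {p | (L.contextGraph C c).Adj p n} := by
  intro a a' h
  simp only [contextKernel, Kernel.comap_apply]
  congr 1
  funext p
  by_cases hp : p.1 ∈ {p | (L.contextGraph C c).Adj p n}
  · rw [override_of_mem _ _ hp, override_of_mem _ _ hp, h _ hp]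
  · rw [override_of_notMem _ _ hp, override_of_notMem _ _ hp]

/-- The absent parents are reset to `a₀` one at a time. Each intermediate assignment still agrees
with `c`, hence extends a label of the next absent edge, and compatibility lets that parent change.
-/
theorem contextKernel_eq_mechanism {V : Type u} [Fintype V] {D : V → Type v}
    [∀ j, MeasurableSpace (D j)] {L : LDAG D} {M : SCM.{u, v, w} L.toDAG D}
    (hM : Compatible L M) {C : Set V} {c : ∀ s : C, D s} {a₀ : ∀ j, D j}
    (ha₀ : ∀ s : C, a₀ s = c s) {n : V} (a : ∀ j, D j)
    (ha : ∀ s : C, L.Adj s n → a s = c s) :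
    contextKernel L M C c a₀ n a = M.mechanism n fun p => a p.1 := by
  classical
  -- `a` is known to agree with `c` only on the parents of `n`; absence of an edge requires
  -- agreement on all of `C`, which `a₁` has.
  let a₁ : ∀ j, D j := override {p | L.Adj p n} a a₀
  have ha₁ : ∀ s : C, a₁ s = c s := fun s => by
    by_cases hs : s.1 ∈ {p | L.Adj p n}
    · simp only [a₁, override_of_mem _ _ hs, ha s hs]
    · simp only [a₁, override_of_notMem _ _ hs, ha₀ s]
  have key : ∀ F : Finset V, (∀ i ∈ F, L.AbsentGiven C c i n) →
      M.mechanism n (fun p => override (F : Set V) a₀ a₁ p.1) = M.mechanism n fun p => a₁ p.1 := by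
    intro F
    induction F using Finset.induction_on with
    | empty => intro _; congr 1; funext p; exact override_of_notMem _ _ (by simp)
    | insert i F hi ih =>
      intro hF
      rw [← ih fun j hj => hF j (Finset.mem_insert_of_mem hj)]
      obtain ⟨l, hl, hal⟩ := hF i (Finset.mem_insert_self _ _) (override (F : Set V) a₀ a₁)
        fun s => by
          by_cases hs : s.1 ∈ (F : Set V)
          · rw [override_of_mem _ _ hs, ha₀]
          · rw [override_of_notMem _ _ hs, ha₁]
      refine (hM i n l hl _ _ (fun p hp => ?_) fun s hs => hal s).symm
      by_cases hpF : p.1 ∈ (F : Set V)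
      · rw [override_of_mem _ _ hpF, override_of_mem _ _ (by simpa using Or.inr hpF)]
      · rw [override_of_notMem _ _ hpF, override_of_notMem _ _ (by simpa [hp] using hpF)]
  have h := key (Finset.univ.filter fun i => L.AbsentGiven C c i n) (by simp)
  have h1 : (fun p : {p : V // L.Adj p n} => a₁ p.1) =
      fun (p : {p : V // L.Adj p n}) => a p.1 :=
    funext fun p => override_of_mem (B := {p | L.Adj p n}) a a₀ p.2
  rw [h1] at h
  rw [← h]
  simp only [contextKernel, Kernel.comap_apply]
  change M.mechanism n _ = _
  congr 1
  funext p
  by_cases hp : L.AbsentGiven C c p n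
  · rw [override_of_notMem (B := {p | (L.contextGraph C c).Adj p n}) _ _ (fun h => h.2 hp),
      override_of_mem _ _ (by simpa using hp)]
  · rw [override_of_mem (B := {p | (L.contextGraph C c).Adj p n}) _ _ ⟨p.2, hp⟩,
      override_of_notMem _ _ (by simpa using hp)]
    exact (override_of_mem (B := {p | L.Adj p n}) a a₀ p.2).symm

/-- A directed path that uses a policy edge ends in a descendant of `X` but starts at a
nondescendant, so it cannot close up. -/
theorem addPolicy_acyclic {V : Type u} (G : DAG V) {PaPi : Set V} {X : V}
    (hP : ∀ s ∈ PaPi, ¬ IsDesc G.toDigraph X s) (a : V) :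
    ¬ Relation.TransGen (addPolicy G.toDigraph PaPi X).Adj a a := by
  have key : ∀ b, Relation.TransGen (addPolicy G.toDigraph PaPi X).Adj a b →
      Relation.TransGen G.Adj a b ∨ (IsDesc G.toDigraph X b ∧ ¬ IsDesc G.toDigraph X a) := by
    intro b h
    induction h with
    | single h =>
      rcases h with h | ⟨h, rfl⟩
      · exact Or.inl (.single h)
      · exact Or.inr ⟨.refl, hP _ h⟩
    | tail _ h ih =>
      rcases h with h | ⟨h, rfl⟩
      · rcases ih with ih | ih
        · exact Or.inl (ih.tail h)
        · exact Or.inr ⟨ih.1.tail h, ih.2⟩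
      · rcases ih with ih | ih
        · exact Or.inr ⟨.refl, fun ha => hP _ h (Relation.ReflTransGen.trans ha ih.to_reflTransGen)⟩
        · exact absurd ih.1 (hP _ h)
  intro h
  rcases key a h with h | h
  · exact G.acyclic a h
  · exact h.2 h.1

theorem adj_asymm_of_acyclic {V : Type u} {G : Digraph V}
    (hG : ∀ a, ¬ Relation.TransGen G.Adj a a) (a b : V) (h : G.Adj a b) : ¬ G.Adj b a :=
  fun h' => hG a ((Relation.TransGen.single h).tail h')

/-! ### Transfer of agreement from `S` to `Y` in a fixed context. -/

/-- If the observational law and the law under the policy agree on the variables in `S` in the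
context `c`, they agree on every `Y ∈ B`, where `B` is separated from the rest by `S`. -/
theorem lintegral_lawDo_eq_of_partition {V : Type u} [Fintype V] [DecidableEq V]
    {D : V → Type v} [∀ j, MeasurableSpace (D j)] [∀ j, StandardBorelSpace (D j)]
    [∀ j, Nonempty (D j)] {L : LDAG D} {M : SCM.{u, v, w} L.toDAG D} (hM : Compatible L M)
    {PaPi : Set V} {X Y : V} (hPaPi : ∀ s ∈ PaPi, ¬ IsDesc L.toDigraph X s)
    {C : Set V} {c : ∀ s : C, D s} (π : Policy D PaPi X) {Q : Set V} (hQ : Q ⊆ PaPi)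
    (hπ : DependsOn (fun a : ∀ j, D j => π.1 fun s => a s) Q) {A B S : Set V} (hCS : C ⊆ S)
    (hSA : S ⊆ A) (hBA : B ⊆ A) (hBS : Disjoint B S) (hY : Y ∈ B)
    (hA : ∀ i j, (addPolicy (L.contextGraph C c) Q X).Adj i j → j ∈ A → i ∈ A)
    (hfam : ∀ n ∈ A,
      (n ∉ B ∧ ∀ p, (addPolicy (L.contextGraph C c) Q X).Adj p n → p ∉ B) ∨
      (n ≠ X ∧ n ∈ B ∪ S ∧ ∀ p, (addPolicy (L.contextGraph C c) Q X).Adj p n → p ∈ B ∪ S))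
    (hS : ∀ f, IsTest C c S f → ∫⁻ a, f a ∂M.lawDo π = ∫⁻ a, f a ∂M.law)
    {f : (∀ j, D j) → ENNReal} (hf : IsTest C c (insert Y C) f) :
    ∫⁻ a, f a ∂M.lawDo π = ∫⁻ a, f a ∂M.law := by
  classical
  have hπM : IsMarkovKernel π.1 := π.2
  let a₀ : ∀ j, D j := extendBy C (fun j => Classical.arbitrary _) c
  have ha₀ : ∀ s : C, a₀ s = c s := fun s => extendBy_of_mem _ _ s.2
  let kπ : Kernel (∀ j, D j) (D X) := π.1.comap (fun a (s : PaPi) => a s) (by fun_prop)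
  -- Index `true` is the observational law, `false` the law under the policy. They differ only at
  -- `X`, whose family misses `B` if `X ∈ A`, so it is never among the kernels that must be shared.
  let k : Bool → ∀ n, Kernel (∀ j, D j) (D n) := fun i =>
    if i then contextKernel L M C c a₀ else Function.update (contextKernel L M C c a₀) X kπ
  have hkX : k false X = kπ := by simp [k]
  have hkn : ∀ i n, n ≠ X → k i n = contextKernel L M C c a₀ n := by
    intro i n h; cases i <;> simp [k, h]
  have hkt : ∀ n, k true n = contextKernel L M C c a₀ n := fun n => by simp [k]
  have hmk : ∀ i n, IsMarkovKernel (k i n) := by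
    intro i n
    by_cases hn : n = X
    · subst hn
      cases i
      · rw [hkX]; infer_instance
      · rw [hkt]; infer_instance
    · rw [hkn i n hn]; infer_instance
  have hctx : ∀ n, DependsOn (fun a => contextKernel L M C c a₀ n a)
      {p | (addPolicy (L.contextGraph C c) Q X).Adj p n} := fun n =>
    (dependsOn_contextKernel L M C c a₀ n).mono fun p hp => Or.inl hp
  obtain ⟨κ, hκ, hκS, hκf⟩ := exists_common_kernel (H := addPolicy L.toDigraph PaPi X)
    (K := addPolicy (L.contextGraph C c) Q X) (A := A) (B := B) (S := S) (C := C) (c := c)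
    (addPolicy_acyclic L.toDAG hPaPi)
    (fun i j h => h.imp (fun h => h.1) fun h => ⟨hQ h.1, h.2⟩) hCS hSA hBS hA
    (fun i => if i then M.law else M.lawDo π) k
    (by
      intro i n
      by_cases hn : n = X
      · subst hn
        cases i
        · rw [hkX]
          exact hπ.mono fun p hp => Or.inr ⟨hp, rfl⟩
        · rw [hkt]; exact hctx n
      · rw [hkn i n hn]; exact hctx n)
    (by
      intro i n
      cases i
      · by_cases hn : n = X
        · subst hn
          rw [hkX]
          exact M.localStep_lawDo_self π
        · rw [hkn _ n hn]
          exact M.localStep_lawDo π hn (contextKernel_eq_mechanism hM ha₀)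
            ((dependsOn_contextKernel L M C c a₀ n).mono fun p hp => hp.1)
      · rw [hkt]
        exact M.localStep_law (fun _ _ h => Or.inl h) (contextKernel_eq_mechanism hM ha₀))
    (by
      intro n hn
      refine (hfam n hn).imp id fun h => ⟨h.2.1, h.2.2, fun i j => ?_⟩
      rw [hkn i n h.1, hkn j n h.1])
  have hfA : IsTest C c A f := hf.mono (Set.insert_subset (hBA hY) (hCS.trans hSA))
    fun s hs _ => Or.inr hs
  have hfBS : IsTest C c (B ∪ S) f :=
    hf.mono (Set.insert_subset (Or.inl hY) (hCS.trans Set.subset_union_right))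
      fun s hs _ => Or.inr hs
  have hdiff : (B ∪ S) \ B = S := by
    rw [Set.union_sdiff_left, hBS.symm.sdiff_eq_left]
  -- Averaging `f` over `B` leaves a test function of `S` alone, to which `hS` applies.
  have hg := hfBS.lintegral_override (B := B) κ (by rwa [hdiff])
  rw [hdiff] at hg
  have h0 := hκf false f hfA
  have h1 := hκf true f hfA
  simp only [Bool.false_eq_true, if_false, if_true] at h0 h1
  rw [h0, h1, hS _ hg]

/-! ### Imitation in a context -/

theorem measurableSet_contextEvent {V : Type u} [Finite V] {D : V → Type v}
    [∀ j, MeasurableSpace (D j)] [∀ j, MeasurableSingletonClass (D j)] (C : Set V)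
    (c : ∀ s : C, D s) : MeasurableSet (contextEvent C c) := by
  have : contextEvent C c = ⋂ s : C, {a | a s = c s} := by ext; simp [contextEvent]
  rw [this]
  exact MeasurableSet.iInter fun s => measurable_pi_apply s.1 (measurableSet_singleton (c s))

/-- A test function for `S ∪ C` only sees the marginal on `S` of the restriction to the
context. -/
theorem IsTest.lintegral_eq_marginal {V : Type u} [Finite V] {D : V → Type v}
    [∀ j, MeasurableSpace (D j)] [∀ j, MeasurableSingletonClass (D j)] [∀ j, Nonempty (D j)]
    {C S : Set V} {c : ∀ s : C, D s} :
    ∀ f : (∀ j, D j) → ENNReal, IsTest C c (S ∪ C) f → ∃ F : (∀ s : S, D s) → ENNReal,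
      ∀ μ : Measure (∀ j, D j),
        ∫⁻ a, f a ∂μ = ∫⁻ s, F s ∂marginal (μ.restrict (contextEvent C c)) S := by
  intro f hf
  let a₀ : ∀ j, D j := extendBy C (fun j => Classical.arbitrary _) c
  have ha₀ : ∀ s : C, a₀ s = c s := fun s => extendBy_of_mem _ _ s.2
  have hm : Measurable fun s : ∀ s : S, D s => f (override C a₀ (extendBy S a₀ s)) :=
    hf.measurable.comp ((measurable_override C).comp
      (measurable_const.prodMk (measurable_extendBy S a₀)))
  refine ⟨fun s => f (override C a₀ (extendBy S a₀ s)), fun μ => ?_⟩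
  rw [marginal, lintegral_map hm (by fun_prop),
    ← lintegral_indicator (measurableSet_contextEvent C c)]
  refine lintegral_congr fun a => ?_
  by_cases ha : a ∈ contextEvent C c
  · rw [Set.indicator_of_mem ha]
    refine hf.dependsOn fun j hj => ?_
    by_cases hjC : j ∈ C
    · rw [override_of_mem _ _ hjC, ha₀ ⟨j, hjC⟩]
      exact ha ⟨j, hjC⟩
    · rw [override_of_notMem _ _ hjC, extendBy_of_mem _ _ (hj.resolve_right hjC)]
  · rw [Set.indicator_of_notMem ha]
    by_contra hfa
    exact ha fun s => hf.support a hfa s (Or.inr s.2)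

theorem isTest_indicator {V : Type u} [Finite V] {D : V → Type v}
    [∀ j, MeasurableSpace (D j)] [∀ j, MeasurableSingletonClass (D j)] (C : Set V)
    (c : ∀ s : C, D s) (Y : V) {T : Set (D Y)} (hT : MeasurableSet T) :
    IsTest C c (insert Y C) ((contextEvent C c ∩ {a | a Y ∈ T}).indicator 1) := by
  refine ⟨measurable_one.indicator ((measurableSet_contextEvent C c).inter
    (measurable_pi_apply Y hT)), fun a a' h => ?_, fun a ha s _ => ?_⟩
  · have : a ∈ contextEvent C c ∩ {a | a Y ∈ T} ↔ a' ∈ contextEvent C c ∩ {a | a Y ∈ T} := by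
      refine and_congr (forall_congr' fun s => ?_) ?_
      · rw [h s (Or.inr s.2)]
      · simp [h Y (Or.inl rfl)]
    by_cases ha : a ∈ contextEvent C c ∩ {a | a Y ∈ T}
    · rw [Set.indicator_of_mem ha, Set.indicator_of_mem (this.1 ha)]; rfl
    · rw [Set.indicator_of_notMem ha, Set.indicator_of_notMem fun h => ha (this.2 h)]
  · exact (Set.mem_of_indicator_ne_zero ha).1 s

/-- Gives both conditional laws in the surrogate equation the same normalizing constant. -/
theorem SCM.lawDo_contextEvent {V : Type u} [Fintype V] [DecidableEq V] {D : V → Type v}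
    [∀ j, MeasurableSpace (D j)] [∀ j, MeasurableSingletonClass (D j)] {G : DAG V}
    (M : SCM.{u, v, w} G D) {PaPi : Set V} {X : V} (π : Policy D PaPi X) {C : Set V}
    (hC : ∀ s ∈ C, ¬ IsDesc G.toDigraph X s) (c : ∀ s : C, D s) :
    M.lawDo π (contextEvent C c) = M.law (contextEvent C c) := by
  have hm := measurableSet_contextEvent C c
  have hdep : DependsOn ((contextEvent C c).indicator (1 : (∀ j, D j) → ENNReal))
      {j | ¬ IsDesc G.toDigraph X j} := by
    intro a a' h
    have : a ∈ contextEvent C c ↔ a' ∈ contextEvent C c :=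
      forall_congr' fun s => by rw [h s (hC s s.2)]
    by_cases ha : a ∈ contextEvent C c
    · rw [Set.indicator_of_mem ha, Set.indicator_of_mem (this.1 ha)]; rfl
    · rw [Set.indicator_of_notMem ha, Set.indicator_of_notMem fun h => ha (this.2 h)]
  rw [← lintegral_indicator_one hm, ← lintegral_indicator_one hm]
  exact M.lintegral_lawDo_of_dependsOn π (W := {j | ¬ IsDesc G.toDigraph X j})
    (fun p q hpq hq hp => hq (Relation.ReflTransGen.tail hp hpq)) (fun h => h .refl)
    (measurable_one.indicator hm) hdep

/-- The partition is taken for the separator `S ∪ C` in the graph with the policy edges. As `X` lies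
neither in `B` nor in the separator, its family is of the kind that misses `B`. -/
theorem lintegral_lawDo_eq_of_surrogate {V : Type u} [Fintype V] [DecidableEq V]
    {D : V → Type v} [∀ j, MeasurableSpace (D j)] [∀ j, StandardBorelSpace (D j)]
    [∀ j, Nonempty (D j)] {L : LDAG D} {M : SCM.{u, v, w} L.toDAG D} (hM : Compatible L M)
    {PaPi : Set V} {X Y : V} (hPaPi : ∀ s ∈ PaPi, ¬ IsDesc L.toDigraph X s)
    {C S : Set V} (hC : C ⊆ PaPi) {c : ∀ s : C, D s} (π : Policy D PaPi X)
    (hsep : DSep (addPolicy (L.contextGraph C c) PaPi X) X Y (S ∪ C))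
    (hS : marginal (ProbabilityTheory.cond (M.lawDo π) (contextEvent C c)) S =
      marginal (ProbabilityTheory.cond M.law (contextEvent C c)) S)
    {f : (∀ j, D j) → ENNReal} (hf : IsTest C c (insert Y C) f) :
    ∫⁻ a, f a ∂M.lawDo π = ∫⁻ a, f a ∂M.law := by
  have hacyc := addPolicy_acyclic L.toDAG hPaPi
  have hsub : ∀ i j, (addPolicy (L.contextGraph C c) PaPi X).Adj i j →
      (addPolicy L.toDigraph PaPi X).Adj i j := fun i j h => h.imp And.left id
  obtain ⟨A, B, hA, hSA, -, hY, hBA, hBS, hXB, hfam⟩ := hsep.exists_partition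
    (adj_asymm_of_acyclic fun a h => hacyc a (Relation.TransGen.mono hsub _ _ h))
  refine lintegral_lawDo_eq_of_partition hM hPaPi π subset_rfl ?_ Set.subset_union_right hSA hBA
    hBS hY hA (fun n hn => (hfam n hn).imp id fun h => ⟨?_, h⟩) ?_ hf
  · intro a a' h
    have : (fun s : PaPi => a s) = fun (s : PaPi) => a' s := funext fun s => h s s.2
    simp only [this]
  · rintro rfl
    exact h.1.elim hXB hsep.1
  · intro g hg
    obtain ⟨F, hF⟩ := hg.lintegral_eq_marginal
    rw [hF, hF]
    have hp := M.lawDo_contextEvent π (fun s hs => hPaPi s (hC hs)) c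
    congr 1
    -- In a null context both restrictions vanish; otherwise the surrogate equation is multiplied by
    -- the common probability of the context.
    by_cases h0 : M.law (contextEvent C c) = 0
    · rw [Measure.restrict_eq_zero.2 h0, Measure.restrict_eq_zero.2 (hp.trans h0)]
    · have htop : M.law (contextEvent C c) ≠ ⊤ := measure_ne_top _ _
      simp only [marginal, ProbabilityTheory.cond, hp, Measure.map_smul] at hS ⊢
      have := congrArg (fun μ => M.law (contextEvent C c) • μ) hS
      simpa only [smul_smul, ENNReal.mul_inv_cancel h0 htop, one_smul] using this

/-- The policy that draws the action from its conditional distribution given the variables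
in `W`. -/
theorem exists_policy_of_backdoor {V : Type u} [Fintype V] [DecidableEq V]
    {D : V → Type v} [∀ j, MeasurableSpace (D j)] [∀ j, StandardBorelSpace (D j)]
    [∀ j, Nonempty (D j)] {L : LDAG D} {M : SCM.{u, v, w} L.toDAG D} (hM : Compatible L M)
    {PaPi : Set V} {X Y : V} (hPaPi : ∀ s ∈ PaPi, ¬ IsDesc L.toDigraph X s)
    {C W : Set V} (hCW : C ⊆ W) (hW : W ⊆ PaPi) {c : ∀ s : C, D s}
    (hsep : DSep (cutOut (L.contextGraph C c) X) X Y W) :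
    ∃ π : Policy D PaPi X, ∀ f : (∀ j, D j) → ENNReal, IsTest C c (insert Y C) f →
      ∫⁻ a, f a ∂M.lawDo π = ∫⁻ a, f a ∂M.law := by
  obtain ⟨A, B, hA, hWA, hXA, hY, hBA, hBW, hXB, hfam⟩ := hsep.exists_partition
    (adj_asymm_of_acyclic fun a h => L.acyclic a (Relation.TransGen.mono
      (fun i j (h : (cutOut (L.contextGraph C c) X).Adj i j) => h.1.1) _ _ h))
  have hXW : X ∉ W := hsep.1
  let res : (∀ j, D j) → ∀ s : W, D s := fun a s => a s
  have hres : Measurable res := by fun_prop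
  let κ : Kernel (∀ s : W, D s) (D X) := condDistrib (fun a => a X) res M.law
  let π : Policy D PaPi X := ⟨κ.comap (fun a s => a ⟨s.1, hW s.2⟩) (by fun_prop), inferInstance⟩
  have hcut : ∀ i j, i ≠ X → (L.contextGraph C c).Adj i j →
      (cutOut (L.contextGraph C c) X).Adj i j := fun i j hi h => ⟨h, hi⟩
  -- The partition comes from the graph without the edges out of `X`. Putting `X` into the separator
  -- makes those edges harmless, and the only policy edges needed start in `W`, since `π` reads
  -- nothing else.
  refine ⟨π, fun f hf => lintegral_lawDo_eq_of_partition hM hPaPi π hW ?_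
    (hCW.trans (Set.subset_insert X W)) (Set.insert_subset hXA hWA) hBA
    (Set.disjoint_insert_right.2 ⟨hXB, hBW⟩) hY ?_ ?_ ?_ hf⟩
  · intro a a' h
    have : res a = res a' := funext fun s => h s s.2
    exact congrArg κ this
  · rintro i j (h | ⟨h, -⟩) hj
    · by_cases hi : i = X
      · rwa [hi]
      · exact hA i j (hcut i j hi h) hj
    · exact hWA h
  · intro n hn
    refine (hfam n hn).imp (fun h => ⟨h.1, ?_⟩) (fun h => ?_)
    · rintro p (hp | ⟨hp, -⟩)
      · by_cases hpX : p = X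
        · rwa [hpX]
        · exact h.2 p (hcut p n hpX hp)
      · exact fun hB => Set.disjoint_left.1 hBW hB hp
    · have hnX : n ≠ X := by
        rintro rfl
        exact h.1.elim hXB hXW
      refine ⟨hnX, h.1.imp id Or.inr, ?_⟩
      rintro p (hp | ⟨hp, -⟩)
      · by_cases hpX : p = X
        · exact Or.inr (Or.inl hpX)
        · exact (h.2 p (hcut p n hpX hp)).imp id Or.inr
      · exact Or.inr (Or.inr hp)
  · intro g hg
    let a₀ : ∀ j, D j := fun j => Classical.arbitrary _
    let F : (∀ s : W, D s) × D X → ENNReal := fun q =>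
      g (Function.update (extendBy W a₀ q.1) X q.2)
    have hF : Measurable F := hg.measurable.comp ((measurable_update_pair X).comp
      (((measurable_extendBy W a₀).comp measurable_fst).prodMk measurable_snd))
    have hgF : ∀ a, g a = F (res a, a X) := fun a => hg.dependsOn fun j hj => by
      by_cases hjX : j = X
      · subst hjX; simp
      · have hjW : j ∈ W := hj.resolve_left hjX
        simp [hjX, extendBy_of_mem _ _ hjW, res]
    have hWX : ∀ s : W, s.1 ∈ {j | ¬ IsDesc L.toDigraph X j} := fun s => hPaPi s (hW s.2)
    have hdo : ∀ e x, g (M.solDo X x e) = F (res (M.sol e), x) := fun e x => by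
      rw [hgF, M.solDo_self]
      congr 2
      exact funext fun s => M.solDo_eq_sol (W := {j | ¬ IsDesc L.toDigraph X j})
        (fun p q hpq hq hp => hq (Relation.ReflTransGen.tail hp hpq)) (fun h => h .refl) x e s
        (hWX s)
    have hin : Measurable fun s => ∫⁻ x, F (s, x) ∂κ s :=
      Measurable.lintegral_kernel_prod_right' hF
    -- `W` contains no descendant of `X`, so under the policy it keeps its law and the action is
    -- drawn from the observational conditional law: the joint law of `W` and `X` is unchanged.
    calc ∫⁻ a, g a ∂M.lawDo π
        = ∫⁻ e, ∫⁻ x, F (res (M.sol e), x) ∂κ (res (M.sol e)) ∂M.exoLaw := by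
          rw [M.lintegral_lawDo π hg.measurable]
          simp only [hdo]
          rfl
      _ = ∫⁻ a, ∫⁻ x, F (res a, x) ∂κ (res a) ∂M.law :=
          (M.lintegral_law (hin.comp hres)).symm
      _ = ∫⁻ s, ∫⁻ x, F (s, x) ∂κ s ∂M.law.map res := (lintegral_map hin hres).symm
      _ = ∫⁻ q, F q ∂(M.law.map res ⊗ₘ κ) := (Measure.lintegral_compProd hF).symm
      _ = ∫⁻ a, F (res a, a X) ∂M.law := by
          rw [compProd_map_condDistrib (measurable_pi_apply X).aemeasurable,
            lintegral_map hF (hres.prodMk (measurable_pi_apply X))]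
      _ = ∫⁻ a, g a ∂M.law := by simp only [hgF]

/-- Policies for the individual contexts can be combined into one. -/
theorem exists_glued_policy {V : Type u} [Fintype V] [DecidableEq V]
    {D : V → Type v} [∀ j, MeasurableSpace (D j)] [∀ j, MeasurableSingletonClass (D j)]
    {G : DAG V} (M : SCM.{u, v, w} G D) {PaPi C : Set V} {X Y : V}
    (hPaPi : ∀ s ∈ PaPi, ¬ IsDesc G.toDigraph X s) (hC : C ⊆ PaPi)
    (hCdisc : ∀ s ∈ C, Countable (D s)) (πc : (∀ s : C, D s) → Policy D PaPi X) :
    ∃ π : Policy D PaPi X, ∀ (c : ∀ s : C, D s) (f : (∀ j, D j) → ENNReal),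
      IsTest C c (insert Y C) f → ∫⁻ a, f a ∂M.lawDo π = ∫⁻ a, f a ∂M.lawDo (πc c) := by
  have : ∀ s : C, Countable (D s) := fun s => hCdisc s s.2
  let κ : Kernel (∀ s : PaPi, D s) (D X) :=
    { toFun := fun a => (πc fun s => a ⟨s.1, hC s.2⟩).1 a
      measurable' := by
        -- Countability of the set of contexts is what makes the arbitrary choice `πc` measurable.
        have h : Measurable fun q : (∀ s : C, D s) × (∀ s : PaPi, D s) => (πc q.1).1 q.2 :=
          measurable_from_prod_countable_right fun c => (πc c).1.measurable
        have h' : Measurable fun a : ∀ s : PaPi, D s =>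
            ((fun s : C => a ⟨s.1, hC s.2⟩ : ∀ s : C, D s), a) := by fun_prop
        exact h.comp h' }
  refine ⟨⟨κ, ⟨fun a => (πc _).2.isProbabilityMeasure a⟩⟩, fun c f hf => ?_⟩
  refine (M.lintegral_lawDo _ hf.measurable).trans
    (Eq.trans ?_ (M.lintegral_lawDo _ hf.measurable).symm)
  refine lintegral_congr fun e => ?_
  by_cases hc : ∀ s : C, M.sol e s = c s
  · have : (fun s : C => M.sol e s) = c := funext hc
    change ∫⁻ x, _ ∂(πc fun s : C => M.sol e s).1 _ = _
    rw [this]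
  -- The action does not alter `C`, so outside the context `f` vanishes whichever action is drawn.
  · have hzero : ∀ x, f (M.solDo X x e) = 0 := by
      intro x
      by_contra hx
      refine hc fun s => ?_
      rw [← hf.support _ hx s (Or.inr s.2)]
      exact (M.solDo_eq_sol (W := {j | ¬ IsDesc G.toDigraph X j})
        (fun p q hpq hq hp => hq (Relation.ReflTransGen.tail hp hpq)) (fun h => h .refl) x e s
        (hPaPi s (hC s.2))).symm
    simp [hzero]

end Imitation

/-! ### Assembly of the contexts. -/

theorem mainTheorem6 {V : Type u} [Fintype V] [DecidableEq V]
    (D : V → Type v) [∀ j, MeasurableSpace (D j)] [∀ j, StandardBorelSpace (D j)]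
    (L : Imitation.LDAG D) (O : Set V) (X Y : V) (hX : X ∈ O) (hY : Y ∉ O)
    (PaPi : Set V) (hPaPi : ∀ s ∈ PaPi, s ∈ O ∧ ¬ Imitation.IsDesc L.toDigraph X s)
    (PO : Measure (∀ s : O, D s))
    (C : Set V) (hC : C ⊆ PaPi ∩ L.contextVars) (hCdisc : ∀ s ∈ C, Countable (D s))
    (h : ∀ c : (∀ s : C, D s),
      (∃ S : Set V, Imitation.IsContextSurrogate L PaPi X Y O C c S ∧
        Imitation.SurrogateSolvable.{u, v, w} L PaPi X O PO C c S) ∨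
      (∃ Z : Set V, Z ⊆ PaPi ∧
        Imitation.DSep (Imitation.cutOut (L.contextGraph C c) X) X Y (Z ∪ C))) :
    Imitation.Imitable.{u, v, w} L PaPi X Y O PO := by
  intro M hM hPO
  -- A standard Borel space may be empty, but the existence of a model rules this out.
  have hne : ∀ j, Nonempty (D j) := fun j =>
    ⟨M.sol (fun i => (nonempty_of_isProbabilityMeasure (M.P i)).some) j⟩
  have hdesc : ∀ s ∈ PaPi, ¬ Imitation.IsDesc L.toDigraph X s := fun s hs => (hPaPi s hs).2
  have hCP : C ⊆ PaPi := fun s hs => (hC hs).1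
  have hloc : ∀ c : ∀ s : C, D s, ∃ π : Imitation.Policy D PaPi X,
      ∀ f : (∀ j, D j) → ENNReal, Imitation.IsTest C c (insert Y C) f →
        ∫⁻ a, f a ∂M.lawDo π = ∫⁻ a, f a ∂M.law := by
    intro c
    rcases h c with ⟨S, hS, hsolv⟩ | ⟨Z, hZ, hsep⟩
    · obtain ⟨π, hπ⟩ := hsolv M hM hPO
      exact ⟨π, fun f hf =>
        Imitation.lintegral_lawDo_eq_of_surrogate hM hdesc hCP π hS.2 hπ hf⟩
    · exact Imitation.exists_policy_of_backdoor hM hdesc Set.subset_union_right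
        (Set.union_subset hZ hCP) hsep
  choose πc hπc using hloc
  obtain ⟨π, hπ⟩ := Imitation.exists_glued_policy (Y := Y) M hdesc hCP hCdisc πc
  refine ⟨π, Measure.ext fun T hT => ?_⟩
  have : ∀ s : C, Countable (D s) := fun s => hCdisc s s.2
  -- The events `C = c` form a countable partition, so the law of `Y` is a sum of integrals of test
  -- functions.
  have hsum : ∀ μ : Measure (∀ j, D j), μ.map (fun a => a Y) T = ∑' c : ∀ s : C, D s,
      ∫⁻ a, (Imitation.contextEvent C c ∩ {a | a Y ∈ T}).indicator 1 a ∂μ := by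
    intro μ
    rw [← lintegral_tsum fun c => (Imitation.isTest_indicator C c Y hT).measurable.aemeasurable,
      Measure.map_apply (measurable_pi_apply Y) hT,
      ← lintegral_indicator_one (measurable_pi_apply Y hT)]
    refine lintegral_congr fun a => ?_
    rw [tsum_eq_single (fun s : C => a s) fun c hc => Set.indicator_of_notMem
      (fun h => hc (funext fun s => (h.1 s).symm)) _]
    by_cases ha : a Y ∈ T
    · rw [Set.indicator_of_mem (show a ∈ (fun a : ∀ j, D j => a Y) ⁻¹' T from ha),
        Set.indicator_of_mem (show a ∈ Imitation.contextEvent C (fun s : C => a s) ∩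
          {a | a Y ∈ T} from ⟨fun _ => rfl, ha⟩)]
    · rw [Set.indicator_of_notMem (show a ∉ (fun a : ∀ j, D j => a Y) ⁻¹' T from ha),
        Set.indicator_of_notMem fun h => ha h.2]
  rw [hsum, hsum]
  refine tsum_congr fun c => ?_
  have ht := Imitation.isTest_indicator C c Y hT
  rw [hπ c _ ht, hπc c _ ht]
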